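/- Let $d\ge 2$ and let $f:\mathbb{R}^d\to\mathbb{R}$ be twice differentiable. Assume that $f$ is $\mu$-strongly convex and $L$-smooth, i.e. $\mu I_d\preceq\nabla^2 f(x)\preceq L I_d$ for all $x$, with $\mu,L>0$, and put $\varkappa=L/\mu$. Assume also that $f$ is $M$-strongly self-concordant, $M>0$, i.e. $\nabla^2 f(y)-\nabla^2 f(x)\preceq M\|y-x\|_z\,\nabla^2 f(w)$ for all $x,y,z,w\in\mathbb{R}^d$, where $\|v\|_z=\sqrt{v^\top\nabla^2 f(z)v}$. For symmetric $G\succeq A\succ0$, $u\in\mathbb{R}^d$ and $\tau\in[0,1]$ put $\mathrm{Broyd}_\tau(G,A,u)=G$ if $Gu=Au$, and otherwise $$\mathrm{Broyd}_\tau(G,A,u)=\tau\Big[G-\tfrac{Auu^\top G+Guu^\top A}{u^\top Au}+\Big(\tfrac{u^\top Gu}{u^\top Au}+1\Big)\tfrac{Auu^\top A}{u^\top Au}\Big]+(1-\tau)\Big[G-\tfrac{(G-A)uu^\top(G-A)}{u^\top(G-A)u}\Big].$$ Let $\mathcal D$ be a probability distribution on $\mathbb{R}^d$ with $\mathbb{E}_{u\sim\mathcal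 D}\,\frac{uu^\top}{u^\top u}=\frac1d I_d$. Starting from deterministic $x_0\in\mathbb{R}^d$ and $G_0$, the random Broyden method computes, for $k\ge0$, $$x_{k+1}=x_k-G_k^{-1}\nabla f(x_k),\quad r_k=\|x_{k+1}-x_k\|_{x_k},\quad \tilde G_k=(1+Mr_k)G_k,\quad G_{k+1}=\mathrm{Broyd}_{\tau_k}\big(\tilde G_k,\nabla^2 f(x_{k+1}),u_k\big),$$ where the directions $u_k\sim\mathcal D$ are drawn independently (each $u_k$ independently of everything chosen in the steps before it), and $\tau_k\in[0,1]$ is an arbitrary, possibly random, choice that may depend on everything drawn up to and including $u_k$ but not on later directions. Write $$\lambda_k=\sqrt{\nabla f(x_k)^\top[\nabla^2 f(x_k)]^{-1}\nabla f(x_k)},\qquad \sigma_k=\mathrm{tr}\big[(G_k-\nabla^2 f(x_k))[\nabla^2 f(x_k)]^{-1}\big].$$ Suppose that $\nabla^2 f(x_0)\preceq G_0\preceq\eta\nabla^2 f(x_0)$ for some $\eta\ge1$, and that $$M\lambda_0\le\frac{\ln 2}{4\eta(2d+1)}.$$ Then for every $\delta\in(0,1)$, with probability at least $1-\delta$ over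 the random choices, the following holds for all $k\ge0$ simultaneously: $$\sigma_k\le\frac{4d^3\varkappa^2\eta}{\delta}\Big(1-\frac1{d\varkappa+1}\Big)^k\quad\text{and}\quad \lambda_k\le\Big(\frac{4d^3\varkappa^2\eta}{\delta}\Big)^k\Big(1-\frac1{d\varkappa+1}\Big)^{k(k-1)/2}\lambda_0.$$ -/

import Mathlib

open scoped MatrixOrder
open MeasureTheory ProbabilityTheory

noncomputable section

namespace RandomBroyden

/-- The Euclidean space of dimension `d`. -/
abbrev Vec (d : ℕ) : Type := EuclideanSpace ℝ (Fin d)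

/-- Real square matrices of size `d`. With `open scoped MatrixOrder`, the relation `A ≤ B` between
such matrices is the Loewner order: `B - A` is positive semidefinite. -/
abbrev Mat (d : ℕ) : Type := Matrix (Fin d) (Fin d) ℝ

/-- `f` is twice differentiable on the whole space. -/
def TwiceDifferentiable {d : ℕ} (f : Vec d → ℝ) : Prop :=
  Differentiable ℝ f ∧ Differentiable ℝ (fderiv ℝ f)

/-- The Hessian matrix of `f` at `x` in the standard basis. -/
def hess {d : ℕ} (f : Vec d → ℝ) (x : Vec d) : Mat d :=
  Matrix.of fun i j =>
    fderiv ℝ (fderiv ℝ f) x (EuclideanSpace.single i 1) (EuclideanSpace.single j 1)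

/-- The quadratic form `vᵀ A v`. -/
def quad {d : ℕ} (A : Mat d) (v : Vec d) : ℝ :=
  dotProduct v.ofLp (A.mulVec v.ofLp)

/-- The norm `‖v‖_A = √(vᵀ A v)` induced by a positive definite matrix `A`. -/
def normWrt {d : ℕ} (A : Mat d) (v : Vec d) : ℝ :=
  Real.sqrt (quad A v)

/-- `f` is twice differentiable, `μ`-strongly convex and `L`-smooth:
`μ I ≤ ∇²f(x) ≤ L I` for all `x`. -/
structure StronglyConvexSmooth {d : ℕ} (f : Vec d → ℝ) (μ L : ℝ) : Prop where
  pos_mu : 0 < μ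
  pos_L : 0 < L
  twice : TwiceDifferentiable f
  lower : ∀ x, μ • (1 : Mat d) ≤ hess f x
  upper : ∀ x, hess f x ≤ L • (1 : Mat d)

/-- `f` is `M`-strongly self-concordant:
`∇²f(y) - ∇²f(x) ≤ M ‖y - x‖_z ∇²f(w)` for all `x, y, z, w`, where `‖·‖_z` is the norm
induced by `∇²f(z)`. -/
structure StronglySelfConcordant {d : ℕ} (f : Vec d → ℝ) (M : ℝ) : Prop where
  pos : 0 < M
  twice : TwiceDifferentiable f
  bound : ∀ x y z w,
    hess f y - hess f x ≤ (M * normWrt (hess f z) (y - x)) • hess f w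

/-- `λ_f(x) = √(∇f(x)ᵀ [∇²f(x)]⁻¹ ∇f(x))`. -/
def lam {d : ℕ} (f : Vec d → ℝ) (x : Vec d) : ℝ :=
  normWrt (hess f x)⁻¹ (gradient f x)

/-- `σ_A(G) = tr[(G - A) A⁻¹]`. -/
def sigma {d : ℕ} (A G : Mat d) : ℝ :=
  ((G - A) * A⁻¹).trace

open Classical in
/-- The Broyden family update `Broyd_τ(G, A, u)`. Here `Matrix.vecMulVec u u` is `u uᵀ`. -/
def broyd {d : ℕ} (τ : ℝ) (G A : Mat d) (u : Vec d) : Mat d :=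
  if G.mulVec u.ofLp = A.mulVec u.ofLp then G
  else
    τ • (G - (quad A u)⁻¹ • (A * Matrix.vecMulVec u.ofLp u.ofLp * G
              + G * Matrix.vecMulVec u.ofLp u.ofLp * A)
          + ((quad G u / quad A u + 1) * (quad A u)⁻¹) •
              (A * Matrix.vecMulVec u.ofLp u.ofLp * A))
      + (1 - τ) • (G - (quad (G - A) u)⁻¹ •
          ((G - A) * Matrix.vecMulVec u.ofLp u.ofLp * (G - A)))

/-- The quasi-Newton step `x - G⁻¹ ∇f(x)`. -/
def newtonStep {d : ℕ} (f : Vec d → ℝ) (x : Vec d) (G : Mat d) : Vec d :=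
  x - WithLp.toLp 2 (G⁻¹.mulVec (gradient f x).ofLp)

/-- The iterates `(x_k, G_k)` of the quasi-Newton method with correction, started at `(x₀, G₀)`,
for given directions `u_k` and parameters `τ_k`:
`x_{k+1} = x_k - G_k⁻¹ ∇f(x_k)`, `r_k = ‖x_{k+1} - x_k‖_{x_k}`,
`G_{k+1} = Broyd_{τ_k}((1 + M r_k) G_k, ∇²f(x_{k+1}), u_k)`. -/
def iterates {d : ℕ} (f : Vec d → ℝ) (M : ℝ) (x₀ : Vec d) (G₀ : Mat d)
    (u : ℕ → Vec d) (τ : ℕ → ℝ) : ℕ → Vec d × Mat d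
  | 0 => (x₀, G₀)
  | k + 1 =>
    let x := (iterates f M x₀ G₀ u τ k).1
    let G := (iterates f M x₀ G₀ u τ k).2
    let x' := newtonStep f x G
    let r := normWrt (hess f x) (x' - x)
    (x', broyd (τ k) ((1 + M * r) • G) (hess f x') (u k))

/-- `λ_k = λ_f(x_k)`. -/
def lamSeq {d : ℕ} (f : Vec d → ℝ) (M : ℝ) (x₀ : Vec d) (G₀ : Mat d)
    (u : ℕ → Vec d) (τ : ℕ → ℝ) (k : ℕ) : ℝ :=
  lam f (iterates f M x₀ G₀ u τ k).1

/-- `σ_k = σ_{∇²f(x_k)}(G_k)`. -/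
def sigmaSeq {d : ℕ} (f : Vec d → ℝ) (M : ℝ) (x₀ : Vec d) (G₀ : Mat d)
    (u : ℕ → Vec d) (τ : ℕ → ℝ) (k : ℕ) : ℝ :=
  sigma (hess f (iterates f M x₀ G₀ u τ k).1) (iterates f M x₀ G₀ u τ k).2

/-- The condition `E_{u ∼ D} [u uᵀ / (uᵀ u)] = (1/d) I`, entry by entry. (The integrand is bounded;
it is `0` at `u = 0`, so that taking traces in the condition shows `u ≠ 0` almost surely.) -/
def IsotropicDirections {d : ℕ} (D : Measure (Vec d)) : Prop :=
  ∀ i j : Fin d,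
    ∫ u, u i * u j / dotProduct u.ofLp u.ofLp ∂D = ((1 / (d : ℝ)) • (1 : Mat d)) i j

/-- The random choices of the method. The directions `u_k` are independent with common law `D`,
and `τ_k ∈ [0, 1]` may depend on `u_0, …, u_k` and on auxiliary randomness, but not on the
directions that are drawn later: `ℱ k` is the information available before `u_k` is drawn. -/
structure RandomChoices {d : ℕ} {Ω : Type*} {m : MeasurableSpace Ω} (P : Measure Ω)
    (ℱ : Filtration ℕ m) (D : Measure (Vec d)) (u : ℕ → Ω → Vec d) (τ : ℕ → Ω → ℝ) : Prop where
  meas_u : ∀ k, Measurable[ℱ (k + 1)] (u k)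
  indep_u : ∀ k, Indep (MeasurableSpace.comap (u k) inferInstance) (ℱ k) P
  law_u : ∀ k, P.map (u k) = D
  meas_tau : ∀ k, Measurable[ℱ (k + 1)] (τ k)
  tau_mem : ∀ k ω, τ k ω ∈ Set.Icc (0 : ℝ) 1

end RandomBroyden

end

/-! A deterministic linear rate comes first. For `η ≥ 1` a Broyden update preserves `A ≤ G ≤ η A`,
and self-concordance makes each correction and change of Hessian cost a factor at most `exp (2 M
λ_k)`. By `lam_newtonStep_le_linear`, this sandwich makes `λ` shrink by `ρ = 1 - 1/(2η)` per step.
The costs therefore form a geometric series and the sandwich never degrades beyond a constant. The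
two bounds support each other in one induction, `iterates_invariants`.

The superlinear rate comes from `σ`. Each update lowers `σ` by at least `uᵀ(G-A)u / uᵀAu`, whatever
`τ` is (`sigma_broyd_le`). Averaged over an isotropic direction independent of the past, this
contracts `σ` by `1 - 1/n`, with `n = dϰ`. Passing to the new Hessian turns `σ` into at most `(1 +
Mλ)² (σ + 2dMλ)`, so the potential `p = σ + 2dMλ` is the natural quantity. The extra factors have a
product of at most 2 by the linear rate and the smallness of `λ_0`, hence `E p_k ≤ 2dη(1 - 1/n)^k`
(`integral_potentialSeq_le`).

Finally `1 - 1/n = (1 - 1/(n+1))(1 - 1/n²)`. The first factor is the claimed rate and the second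
makes the Markov bounds summable, with total failure probability at most `δ`. Off the failure event
`λ_{k+1} ≤ 2 p_k λ_k`, and multiplying these inequalities gives the bound on `λ_k`. -/

namespace RandomBroyden

open Matrix

/-! ### Loewner order, dual norms and traces -/

section Loewner

variable {n : Type*} {A B E : Matrix n n ℝ} {c : ℝ}

theorem transpose_eq_of_isHermitian (hA : A.IsHermitian) : Aᵀ = A := by
  have h := hA.eq
  rwa [conjTranspose_eq_transpose_of_trivial] at h

theorem isHermitian_of_le (h : A ≤ B) (hA : A.IsHermitian) : B.IsHermitian := by
  have := (le_iff.1 h).isHermitian.add hA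
  rwa [sub_add_cancel] at this

theorem isHermitian_smul (hA : A.IsHermitian) (c : ℝ) : (c • A).IsHermitian :=
  hA.smul (IsSelfAdjoint.all c)

theorem smul_le_smul_right_of_posSemidef (hA : A.PosSemidef) {a b : ℝ} (h : a ≤ b) :
    a • A ≤ b • A := by
  rw [le_iff, ← sub_smul]
  exact hA.smul (sub_nonneg.2 h)

theorem smul_le_smul_left_of_nonneg (h : A ≤ B) (hc : 0 ≤ c) : c • A ≤ c • B := by
  rw [le_iff, ← smul_sub]
  exact (le_iff.1 h).smul hc

theorem posDef_of_le (hA : A.PosDef) (h : A ≤ B) : B.PosDef := by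
  have := hA.add_posSemidef (le_iff.1 h)
  rwa [add_sub_cancel] at this

variable [Fintype n]

theorem dotProduct_mulVec_comm (hA : A.IsHermitian) (v w : n → ℝ) :
    v ⬝ᵥ A *ᵥ w = w ⬝ᵥ A *ᵥ v := by
  rw [dotProduct_mulVec, ← mulVec_transpose, transpose_eq_of_isHermitian hA, dotProduct_comm]

theorem nonneg_of_posSemidef (hA : A.PosSemidef) (v : n → ℝ) : 0 ≤ v ⬝ᵥ A *ᵥ v := by
  simpa using hA.dotProduct_mulVec_nonneg v

theorem dotProduct_mulVec_le (h : A ≤ B) (v : n → ℝ) : v ⬝ᵥ A *ᵥ v ≤ v ⬝ᵥ B *ᵥ v := by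
  have := nonneg_of_posSemidef (le_iff.1 h) v
  rw [sub_mulVec, dotProduct_sub] at this
  linarith

theorem le_of_dotProduct_mulVec_le (hA : A.IsHermitian) (hB : B.IsHermitian)
    (h : ∀ v, v ⬝ᵥ A *ᵥ v ≤ v ⬝ᵥ B *ᵥ v) : A ≤ B := by
  refine le_iff.2 (PosSemidef.of_dotProduct_mulVec_nonneg (hB.sub hA) fun v => ?_)
  have := h v
  simp only [star_trivial, sub_mulVec, dotProduct_sub]
  linarith

/-- Cauchy-Schwarz for a symmetric matrix `E` with `-cA ≤ E ≤ cA`. -/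
theorem sq_dotProduct_mulVec_le (hE : E.IsHermitian) (h₁ : E ≤ c • A) (h₂ : -(c • A) ≤ E)
    (v w : n → ℝ) :
    (v ⬝ᵥ E *ᵥ w) ^ 2 ≤ (c * (v ⬝ᵥ A *ᵥ v)) * (c * (w ⬝ᵥ A *ᵥ w)) := by
  -- Add the bound `E ≤ cA` at `tv + w` to the bound `-cA ≤ E` at `tv - w`: the cross terms of `A`
  -- cancel and those of `E` add up. The discriminant then gives the claim.
  have key : ∀ t : ℝ, 0 ≤ (c * (v ⬝ᵥ A *ᵥ v)) * (t * t) + (-2 * (v ⬝ᵥ E *ᵥ w)) * t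
      + c * (w ⬝ᵥ A *ᵥ w) := by
    intro t
    have e1 := dotProduct_mulVec_le h₁ (t • v + w)
    have e2 := dotProduct_mulVec_le h₂ (t • v - w)
    have e3 := dotProduct_mulVec_comm hE w v
    simp only [neg_mulVec, smul_mulVec, mulVec_add, mulVec_sub, mulVec_smul, dotProduct_add,
      add_dotProduct, sub_dotProduct, dotProduct_sub, smul_dotProduct, dotProduct_smul,
      dotProduct_neg, smul_eq_mul] at e1 e2
    rw [e3] at e1 e2
    linarith
  have := discrim_le_zero key
  rw [discrim] at this
  linarith

theorem sq_dotProduct_mulVec_le_of_posSemidef (hA : A.PosSemidef) (v w : n → ℝ) :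
    (v ⬝ᵥ A *ᵥ w) ^ 2 ≤ (v ⬝ᵥ A *ᵥ v) * (w ⬝ᵥ A *ᵥ w) := by
  have h2 : -((1 : ℝ) • A) ≤ A := by
    rw [one_smul, le_iff, sub_neg_eq_add]
    exact hA.add hA
  have := sq_dotProduct_mulVec_le (c := 1) hA.isHermitian (by rw [one_smul]) h2 v w
  simpa using this

theorem trace_vecMulVec_mul (v w : n → ℝ) (B : Matrix n n ℝ) :
    (vecMulVec v w * B).trace = w ⬝ᵥ B *ᵥ v := by
  rw [vecMulVec_mul, trace_vecMulVec, dotProduct_comm, dotProduct_mulVec]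

theorem trace_mul_le_trace_mul (hE : E.PosSemidef) (h : A ≤ B) :
    (E * A).trace ≤ (E * B).trace := by
  obtain ⟨m, v, rfl⟩ := posSemidef_iff_eq_sum_vecMulVec.1 hE
  simp only [Finset.sum_mul, trace_sum, star_trivial, trace_vecMulVec_mul]
  exact Finset.sum_le_sum fun i _ => dotProduct_mulVec_le h _

variable [DecidableEq n]

theorem mulVec_inv_mulVec (hA : A.PosDef) (v : n → ℝ) : A *ᵥ (A⁻¹ *ᵥ v) = v := by
  rw [mulVec_mulVec, mul_nonsing_inv _ ((isUnit_iff_isUnit_det _).1 hA.isUnit), one_mulVec]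

theorem inv_mulVec_mulVec (hA : A.PosDef) (v : n → ℝ) : A⁻¹ *ᵥ (A *ᵥ v) = v := by
  rw [mulVec_mulVec, nonsing_inv_mul _ ((isUnit_iff_isUnit_det _).1 hA.isUnit), one_mulVec]

theorem inv_smul_of_posDef (hA : A.PosDef) (hc : c ≠ 0) : (c • A)⁻¹ = c⁻¹ • A⁻¹ := by
  refine inv_eq_left_inv ?_
  rw [smul_mul_smul_comm, nonsing_inv_mul _ ((isUnit_iff_isUnit_det _).1 hA.isUnit),
    inv_mul_cancel₀ hc, one_smul]

/-- Expand `(B⁻¹v - A⁻¹v)ᵀ A (B⁻¹v - A⁻¹v) ≥ 0` and bound its first term with `A ≤ B` at the vector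
`B⁻¹v`. -/
theorem inv_le_inv_of_posDef (hA : A.PosDef) (h : A ≤ B) : B⁻¹ ≤ A⁻¹ := by
  have hB := posDef_of_le hA h
  refine le_of_dotProduct_mulVec_le hB.inv.isHermitian hA.inv.isHermitian fun v => ?_
  have e1 := nonneg_of_posSemidef hA.posSemidef (B⁻¹ *ᵥ v - A⁻¹ *ᵥ v)
  have e2 := dotProduct_mulVec_le h (B⁻¹ *ᵥ v)
  rw [mulVec_inv_mulVec hB] at e2
  rw [mulVec_sub, mulVec_inv_mulVec hA, sub_dotProduct, dotProduct_sub, dotProduct_sub,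
    dotProduct_mulVec_comm hA.isHermitian (A⁻¹ *ᵥ v), mulVec_inv_mulVec hA,
    dotProduct_comm (B⁻¹ *ᵥ v) v, dotProduct_comm (A⁻¹ *ᵥ v) v] at e1
  rw [dotProduct_comm (B⁻¹ *ᵥ v) v] at e2
  linarith

/-- Cauchy-Schwarz between the norm of a positive definite matrix and its dual norm. -/
theorem sq_dotProduct_le (hA : A.PosDef) (v w : n → ℝ) :
    (v ⬝ᵥ w) ^ 2 ≤ (v ⬝ᵥ A⁻¹ *ᵥ v) * (w ⬝ᵥ A *ᵥ w) := by
  have := sq_dotProduct_mulVec_le_of_posSemidef hA.posSemidef (A⁻¹ *ᵥ v) w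
  rw [dotProduct_mulVec_comm hA.isHermitian (A⁻¹ *ᵥ v) w, mulVec_inv_mulVec hA,
    dotProduct_comm w v, dotProduct_comm (A⁻¹ *ᵥ v) v] at this
  exact this

/-- A bound on all pairings with `y` bounds the dual norm of `y`. -/
theorem dual_le_of_forall (hA : A.PosDef) {y : n → ℝ} {b : ℝ} (hb : 0 ≤ b)
    (h : ∀ v : n → ℝ, (v ⬝ᵥ y) ^ 2 ≤ b * (v ⬝ᵥ A *ᵥ v)) : y ⬝ᵥ A⁻¹ *ᵥ y ≤ b := by
  have := h (A⁻¹ *ᵥ y)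
  rw [mulVec_inv_mulVec hA, dotProduct_comm] at this
  rcases (nonneg_of_posSemidef hA.inv.posSemidef y).eq_or_lt with h0 | h0
  · rwa [← h0]
  · rw [sq] at this
    exact le_of_mul_le_mul_right this h0

/-- Turns an order bound on `E` into an operator bound from the `A`-norm to its dual, which is how
`G - ∇²f` enters the estimates of the new gradient. -/
theorem dual_mulVec_le (hA : A.PosDef) (hE : E.PosSemidef) (hc : 0 ≤ c) (h : E ≤ c • A)
    (s : n → ℝ) : (E *ᵥ s) ⬝ᵥ A⁻¹ *ᵥ (E *ᵥ s) ≤ c ^ 2 * (s ⬝ᵥ A *ᵥ s) := by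
  refine dual_le_of_forall hA
    (mul_nonneg (sq_nonneg _) (nonneg_of_posSemidef hA.posSemidef s)) fun v => ?_
  have h2 : -(c • A) ≤ E := by
    rw [le_iff, sub_neg_eq_add]
    exact hE.add (hA.posSemidef.smul hc)
  have := sq_dotProduct_mulVec_le hE.isHermitian h h2 v s
  linarith

/-- Decompose `E` into rank-one terms `vvᵀ`. Cauchy-Schwarz gives `vvᵀ ≤ (vᵀA⁻¹v) A`, and the
coefficients add up to the trace. -/
theorem le_trace_smul (hA : A.PosDef) (hE : E.PosSemidef) : E ≤ (E * A⁻¹).trace • A := by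
  refine le_of_dotProduct_mulVec_le hE.isHermitian (isHermitian_smul hA.isHermitian _)
    fun w => ?_
  obtain ⟨m, v, rfl⟩ := posSemidef_iff_eq_sum_vecMulVec.1 hE
  simp only [Finset.sum_mul, trace_sum, star_trivial, trace_vecMulVec_mul, sum_mulVec,
    dotProduct_sum, vecMulVec_mulVec, smul_mulVec, dotProduct_smul, smul_eq_mul]
  refine Finset.sum_le_sum fun i _ => ?_
  have := sq_dotProduct_le hA (v i) w
  simp only [MulOpposite.smul_eq_mul_unop, MulOpposite.unop_op]
  rw [dotProduct_comm w (v i)]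
  linarith

theorem inv_le_smul_one (hc : 0 < c) (h : c • 1 ≤ A) : A⁻¹ ≤ c⁻¹ • 1 := by
  have := inv_le_inv_of_posDef (PosDef.one.smul hc) h
  rwa [inv_smul_of_posDef PosDef.one hc.ne', inv_one] at this

end Loewner

/-! ### The Broyden update: order bounds and decrease of the trace -/

section BroydenUpdate

variable {d : ℕ} {A G : Mat d}

theorem dotProduct_mul_vecMulVec_mul_mulVec (A G : Mat d) (u v w : Fin d → ℝ) :
    v ⬝ᵥ (A * vecMulVec u u * G) *ᵥ w = (v ⬝ᵥ A *ᵥ u) * (u ⬝ᵥ G *ᵥ w) := by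
  rw [← mulVec_mulVec, ← mulVec_mulVec, vecMulVec_mulVec, op_smul_eq_smul, mulVec_smul,
    dotProduct_smul, smul_eq_mul, mul_comm]

theorem trace_mul_vecMulVec_mul_mul (A G B : Mat d) (u : Fin d → ℝ) :
    (A * vecMulVec u u * G * B).trace = u ⬝ᵥ (G * B * A) *ᵥ u := by
  rw [mul_assoc, mul_assoc, trace_mul_comm, mul_assoc, trace_vecMulVec_mul]

/-- The Davidon-Fletcher-Powell update. -/
noncomputable def dfp (G A : Mat d) (u : Vec d) : Mat d :=
  G - (quad A u)⁻¹ • (A * vecMulVec u.ofLp u.ofLp * G + G * vecMulVec u.ofLp u.ofLp * A)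
    + ((quad G u / quad A u + 1) * (quad A u)⁻¹) • (A * vecMulVec u.ofLp u.ofLp * A)

/-- The symmetric rank one update. -/
noncomputable def sr1 (G A : Mat d) (u : Vec d) : Mat d :=
  G - (quad (G - A) u)⁻¹ • ((G - A) * vecMulVec u.ofLp u.ofLp * (G - A))

theorem broyd_of_eq (τ : ℝ) {u : Vec d} (h : G *ᵥ u.ofLp = A *ᵥ u.ofLp) :
    broyd τ G A u = G := if_pos h

theorem broyd_of_ne (τ : ℝ) {u : Vec d} (h : G *ᵥ u.ofLp ≠ A *ᵥ u.ofLp) :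
    broyd τ G A u = τ • dfp G A u + (1 - τ) • sr1 G A u := if_neg h

theorem quad_pos (hA : A.PosDef) {u : Vec d} (hu : u.ofLp ≠ 0) : 0 < quad A u := by
  simpa [quad] using hA.dotProduct_mulVec_pos hu

theorem isHermitian_dfp (hG : G.IsHermitian) (hA : A.IsHermitian) (u : Vec d) :
    (dfp G A u).IsHermitian := by
  have h1 := transpose_eq_of_isHermitian hG
  have h2 := transpose_eq_of_isHermitian hA
  rw [IsHermitian, conjTranspose_eq_transpose_of_trivial, dfp]
  simp only [transpose_add, transpose_sub, transpose_smul, transpose_mul, transpose_vecMulVec,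
    h1, h2, ← mul_assoc]
  rw [add_comm (G * vecMulVec u.ofLp u.ofLp * A)]

theorem isHermitian_sr1 (hG : G.IsHermitian) (hA : A.IsHermitian) (u : Vec d) :
    (sr1 G A u).IsHermitian := by
  have h1 := transpose_eq_of_isHermitian hG
  have h2 := transpose_eq_of_isHermitian hA
  rw [IsHermitian, conjTranspose_eq_transpose_of_trivial, sr1]
  simp only [transpose_sub, transpose_smul, transpose_mul, transpose_vecMulVec, h1, h2,
    ← mul_assoc]

/-- Split `v` into its component along `u` and an `A`-orthogonal remainder: DFP keeps `G` on the
remainder and puts `A` on the component. The same splitting of `A` in `dotProduct_eq_sub_add` then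
makes both order bounds termwise. -/
theorem dotProduct_dfp_mulVec (hG : G.IsHermitian) (hA : A.IsHermitian) {u : Vec d}
    (hu : quad A u ≠ 0) (v : Fin d → ℝ) :
    v ⬝ᵥ dfp G A u *ᵥ v =
      (v - ((v ⬝ᵥ A *ᵥ u.ofLp) / quad A u) • u.ofLp) ⬝ᵥ G *ᵥ
        (v - ((v ⬝ᵥ A *ᵥ u.ofLp) / quad A u) • u.ofLp)
      + ((v ⬝ᵥ A *ᵥ u.ofLp) / quad A u) ^ 2 * quad A u := by
  simp only [dfp, add_mulVec, sub_mulVec, smul_mulVec, dotProduct_add, dotProduct_sub,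
    dotProduct_smul, mulVec_sub, mulVec_smul, sub_dotProduct, smul_dotProduct, smul_eq_mul,
    dotProduct_mul_vecMulVec_mul_mulVec]
  rw [dotProduct_mulVec_comm hG u.ofLp v, dotProduct_mulVec_comm hA u.ofLp v]
  rw [show u.ofLp ⬝ᵥ G *ᵥ u.ofLp = quad G u from rfl]
  field_simp
  ring

theorem dotProduct_eq_sub_add (hA : A.IsHermitian) {u : Vec d}
    (hu : quad A u ≠ 0) (v : Fin d → ℝ) :
    v ⬝ᵥ A *ᵥ v =
      (v - ((v ⬝ᵥ A *ᵥ u.ofLp) / quad A u) • u.ofLp) ⬝ᵥ A *ᵥ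
        (v - ((v ⬝ᵥ A *ᵥ u.ofLp) / quad A u) • u.ofLp)
      + ((v ⬝ᵥ A *ᵥ u.ofLp) / quad A u) ^ 2 * quad A u := by
  simp only [dotProduct_sub, mulVec_sub, mulVec_smul, sub_dotProduct, smul_dotProduct,
    dotProduct_smul, smul_eq_mul]
  rw [dotProduct_mulVec_comm hA u.ofLp v]
  rw [show u.ofLp ⬝ᵥ A *ᵥ u.ofLp = quad A u from rfl]
  field_simp
  ring

theorem dotProduct_sr1_mulVec (hG : G.IsHermitian) (hA : A.IsHermitian) (u : Vec d)
    (v : Fin d → ℝ) :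
    v ⬝ᵥ sr1 G A u *ᵥ v =
      v ⬝ᵥ G *ᵥ v - (v ⬝ᵥ (G - A) *ᵥ u.ofLp) ^ 2 / quad (G - A) u := by
  rw [sr1, sub_mulVec G, smul_mulVec, dotProduct_sub v, dotProduct_smul, smul_eq_mul,
    dotProduct_mul_vecMulVec_mul_mulVec, dotProduct_mulVec_comm (hG.sub hA) u.ofLp v]
  ring

theorem le_dfp (hA : A.PosDef) (hG : A ≤ G) {u : Vec d} (hu : u.ofLp ≠ 0) : A ≤ dfp G A u := by
  have hGh := isHermitian_of_le hG hA.isHermitian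
  refine le_of_dotProduct_mulVec_le hA.isHermitian (isHermitian_dfp hGh hA.isHermitian u)
    fun v => ?_
  have ha := (quad_pos hA hu).ne'
  rw [dotProduct_dfp_mulVec hGh hA.isHermitian ha, dotProduct_eq_sub_add hA.isHermitian ha]
  gcongr
  exact dotProduct_mulVec_le hG _

theorem dfp_le {η : ℝ} (hη : 1 ≤ η) (hA : A.PosDef) (hAG : A ≤ G) (hG : G ≤ η • A) {u : Vec d}
    (hu : u.ofLp ≠ 0) : dfp G A u ≤ η • A := by
  have hGh := isHermitian_of_le hAG hA.isHermitian
  refine le_of_dotProduct_mulVec_le (isHermitian_dfp hGh hA.isHermitian u)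
    (isHermitian_smul hA.isHermitian _) fun v => ?_
  have ha := quad_pos hA hu
  have := dotProduct_mulVec_le hG (v - ((v ⬝ᵥ A *ᵥ u.ofLp) / quad A u) • u.ofLp)
  rw [smul_mulVec, dotProduct_smul, smul_eq_mul] at this ⊢
  rw [dotProduct_dfp_mulVec hGh hA.isHermitian ha.ne',
    dotProduct_eq_sub_add hA.isHermitian ha.ne', mul_add]
  refine add_le_add this (le_mul_of_one_le_left ?_ hη)
  positivity

theorem le_sr1 (hA : A.PosDef) (hG : A ≤ G) (u : Vec d) : A ≤ sr1 G A u := by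
  have hGh := isHermitian_of_le hG hA.isHermitian
  refine le_of_dotProduct_mulVec_le hA.isHermitian (isHermitian_sr1 hGh hA.isHermitian u)
    fun v => ?_
  rw [dotProduct_sr1_mulVec hGh hA.isHermitian]
  have hE := le_iff.1 hG
  have e1 := sq_dotProduct_mulVec_le_of_posSemidef hE v u.ofLp
  have e2 := nonneg_of_posSemidef hE v
  have e3 := nonneg_of_posSemidef hE u.ofLp
  -- This also covers a vanishing denominator, where the quotient is 0 by convention.
  have : (v ⬝ᵥ (G - A) *ᵥ u.ofLp) ^ 2 / quad (G - A) u ≤ v ⬝ᵥ (G - A) *ᵥ v :=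
    div_le_of_le_mul₀ e3 e2 e1
  rw [sub_mulVec _ _ v, dotProduct_sub v] at this
  linarith

theorem sr1_le (hA : A.PosDef) (hG : A ≤ G) (u : Vec d) : sr1 G A u ≤ G := by
  have hGh := isHermitian_of_le hG hA.isHermitian
  refine le_of_dotProduct_mulVec_le (isHermitian_sr1 hGh hA.isHermitian u) hGh
    fun v => ?_
  rw [dotProduct_sr1_mulVec hGh hA.isHermitian]
  have e3 : 0 ≤ quad (G - A) u := nonneg_of_posSemidef (le_iff.1 hG) u.ofLp
  have : 0 ≤ (v ⬝ᵥ (G - A) *ᵥ u.ofLp) ^ 2 / quad (G - A) u := by positivity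
  linarith

theorem ne_zero_of_mulVec_ne {u : Vec d} (h : G *ᵥ u.ofLp ≠ A *ᵥ u.ofLp) : u.ofLp ≠ 0 := by
  rintro h0
  simp [h0] at h

theorem le_broyd {τ : ℝ} (hτ : τ ∈ Set.Icc (0 : ℝ) 1) (hA : A.PosDef) (hG : A ≤ G) (u : Vec d) :
    A ≤ broyd τ G A u := by
  by_cases h : G *ᵥ u.ofLp = A *ᵥ u.ofLp
  · rwa [broyd_of_eq τ h]
  · rw [broyd_of_ne τ h]
    have e1 := smul_le_smul_left_of_nonneg (le_dfp hA hG (ne_zero_of_mulVec_ne h)) hτ.1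
    have e2 := smul_le_smul_left_of_nonneg (le_sr1 hA hG u) (sub_nonneg.2 hτ.2)
    have := add_le_add e1 e2
    rwa [← add_smul, add_sub_cancel, one_smul] at this

theorem broyd_le {τ η : ℝ} (hτ : τ ∈ Set.Icc (0 : ℝ) 1) (hη : 1 ≤ η) (hA : A.PosDef)
    (hAG : A ≤ G) (hG : G ≤ η • A) (u : Vec d) : broyd τ G A u ≤ η • A := by
  by_cases h : G *ᵥ u.ofLp = A *ᵥ u.ofLp
  · rwa [broyd_of_eq τ h]
  · rw [broyd_of_ne τ h]
    have e1 := smul_le_smul_left_of_nonneg (dfp_le hη hA hAG hG (ne_zero_of_mulVec_ne h)) hτ.1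
    have e2 := smul_le_smul_left_of_nonneg ((sr1_le hA hAG u).trans hG) (sub_nonneg.2 hτ.2)
    have := add_le_add e1 e2
    rwa [← add_smul, add_sub_cancel, one_smul] at this

/-- Each of the two mixed terms times `A⁻¹` has trace `uᵀGu`, and `AuuᵀA` times `A⁻¹` has trace
`uᵀAu`. -/
theorem sigma_dfp (hA : A.PosDef) {u : Vec d} (hu : u.ofLp ≠ 0) :
    sigma A (dfp G A u) = sigma A G - quad (G - A) u / quad A u := by
  have ha := (quad_pos hA hu).ne'
  have hi := mul_nonsing_inv A ((isUnit_iff_isUnit_det _).1 hA.isUnit)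
  have hi' := nonsing_inv_mul A ((isUnit_iff_isUnit_det _).1 hA.isUnit)
  simp only [sigma, dfp, sub_mul, add_mul, smul_mul_assoc, trace_sub, trace_add, trace_smul,
    smul_eq_mul, trace_mul_vecMulVec_mul_mul, hi, one_mul]
  rw [mul_assoc G A⁻¹ A, hi', mul_one]
  rw [show quad (G - A) u = quad G u - quad A u by
    simp [quad, sub_mulVec, dotProduct_sub]]
  rw [show u.ofLp ⬝ᵥ A *ᵥ u.ofLp = quad A u from rfl,
    show u.ofLp ⬝ᵥ G *ᵥ u.ofLp = quad G u from rfl]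
  field_simp
  ring

theorem sigma_sr1_le (hA : A.PosDef) (hG : A ≤ G) {u : Vec d}
    (hu : G *ᵥ u.ofLp ≠ A *ᵥ u.ofLp) :
    sigma A (sr1 G A u) ≤ sigma A G - quad (G - A) u / quad A u := by
  have hE := le_iff.1 hG
  have ha := quad_pos hA (ne_zero_of_mulVec_ne hu)
  -- A semidefinite form vanishes only on the kernel of its matrix, and `u` is not in the kernel of
  -- `G - A`.
  have he : 0 < quad (G - A) u := by
    refine (nonneg_of_posSemidef hE u.ofLp).lt_of_ne fun h0 => hu ?_
    have := (hE.dotProduct_mulVec_zero_iff u.ofLp).1 (by simpa using h0.symm)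
    rwa [sub_mulVec, sub_eq_zero] at this
  have key : sigma A (sr1 G A u) = sigma A G -
      (quad (G - A) u)⁻¹ * (((G - A) *ᵥ u.ofLp) ⬝ᵥ A⁻¹ *ᵥ ((G - A) *ᵥ u.ofLp)) := by
    rw [sigma, sr1, sub_right_comm, sub_mul, trace_sub, smul_mul_assoc, trace_smul,
      trace_mul_vecMulVec_mul_mul, ← mulVec_mulVec, ← mulVec_mulVec,
      dotProduct_mulVec_comm hE.isHermitian, dotProduct_comm, smul_eq_mul]
    rfl
  -- With `e = (G - A)u` the decrease is `eᵀA⁻¹e / uᵀe`; compare it with `uᵀe / uᵀAu` by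
  -- Cauchy-Schwarz.
  have cs := sq_dotProduct_le hA ((G - A) *ᵥ u.ofLp) u.ofLp
  rw [dotProduct_comm] at cs
  change quad (G - A) u ^ 2 ≤ _ * quad A u at cs
  rw [key, sub_le_sub_iff_left, div_le_iff₀ ha, mul_assoc, le_inv_mul_iff₀ he]
  linarith

/-- Each Broyden update decreases `sigma` by at least the ratio of quadratic forms. -/
theorem sigma_broyd_le {τ : ℝ} (hτ : τ ∈ Set.Icc (0 : ℝ) 1) (hA : A.PosDef) (hG : A ≤ G)
    (u : Vec d) :
    sigma A (broyd τ G A u) ≤ sigma A G - quad (G - A) u / quad A u := by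
  by_cases h : G *ᵥ u.ofLp = A *ᵥ u.ofLp
  · rw [broyd_of_eq τ h, quad, sub_mulVec, h]
    simp
  · rw [broyd_of_ne τ h]
    have e1 := sigma_dfp (G := G) hA (ne_zero_of_mulVec_ne h)
    have e2 := sigma_sr1_le hA hG h
    have e3 : sigma A (τ • dfp G A u + (1 - τ) • sr1 G A u)
        = τ * sigma A (dfp G A u) + (1 - τ) * sigma A (sr1 G A u) := by
      simp only [sigma, sub_mul, add_mul, smul_mul_assoc, trace_sub, trace_add, trace_smul,
        smul_eq_mul]
      ring
    rw [e3, e1]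
    have := mul_le_mul_of_nonneg_left e2 (sub_nonneg.2 hτ.2)
    linarith

end BroydenUpdate

/-! ### Local norms -/

section LocalNorm

variable {d : ℕ} {A B : Mat d} {c : ℝ}

theorem normWrt_nonneg (A : Mat d) (v : Vec d) : 0 ≤ normWrt A v := Real.sqrt_nonneg _

theorem quad_nonneg (hA : A.PosSemidef) (v : Vec d) : 0 ≤ quad A v := nonneg_of_posSemidef hA _

theorem sq_normWrt (hA : A.PosSemidef) (v : Vec d) : normWrt A v ^ 2 = quad A v :=
  Real.sq_sqrt (quad_nonneg hA v)

theorem quad_smul (A : Mat d) (t : ℝ) (v : Vec d) : quad A (t • v) = t ^ 2 * quad A v := by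
  simp only [quad, WithLp.ofLp_smul, mulVec_smul, smul_dotProduct, dotProduct_smul, smul_eq_mul]
  ring

theorem normWrt_smul (A : Mat d) (t : ℝ) (v : Vec d) :
    normWrt A (t • v) = |t| * normWrt A v := by
  rw [normWrt, quad_smul, Real.sqrt_mul (sq_nonneg t), Real.sqrt_sq_eq_abs, normWrt]

theorem normWrt_sub_comm (A : Mat d) (v w : Vec d) : normWrt A (v - w) = normWrt A (w - v) := by
  have := normWrt_smul A (-1) (v - w)
  rw [neg_one_smul, neg_sub] at this
  rw [this, abs_neg, abs_one, one_mul]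

theorem normWrt_add_le (hA : A.PosSemidef) (v w : Vec d) :
    normWrt A (v + w) ≤ normWrt A v + normWrt A w := by
  have cs := sq_dotProduct_mulVec_le_of_posSemidef hA v.ofLp w.ofLp
  change _ ≤ quad A v * quad A w at cs
  rw [← sq_normWrt hA, ← sq_normWrt hA, ← mul_pow] at cs
  have h := (abs_le_of_sq_le_sq' cs (mul_nonneg (normWrt_nonneg A v) (normWrt_nonneg A w))).2
  refine Real.sqrt_le_iff.2 ⟨add_nonneg (normWrt_nonneg A v) (normWrt_nonneg A w), ?_⟩
  have e : quad A (v + w) = quad A v + 2 * (v.ofLp ⬝ᵥ A *ᵥ w.ofLp) + quad A w := by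
    simp only [quad, WithLp.ofLp_add, mulVec_add, add_dotProduct, dotProduct_add]
    rw [dotProduct_mulVec_comm hA.isHermitian w.ofLp v.ofLp]
    ring
  rw [e, ← sq_normWrt hA, ← sq_normWrt hA]
  linarith

theorem normWrt_le_of_quad_le {v w : Vec d} {c : ℝ} (hc : 0 ≤ c)
    (h : quad A v ≤ c ^ 2 * quad B w) : normWrt A v ≤ c * normWrt B w := by
  refine (Real.sqrt_le_sqrt h).trans ?_
  rw [Real.sqrt_mul (sq_nonneg c), Real.sqrt_sq hc, normWrt]

end LocalNorm

/-! ### The trace measure of approximation quality -/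

section Sigma

variable {d : ℕ} {A G : Mat d}

theorem sigma_nonneg (hA : A.PosDef) (h : A ≤ G) : 0 ≤ sigma A G := by
  have := trace_mul_le_trace_mul (le_iff.1 h) (nonneg_iff_posSemidef.2 hA.inv.posSemidef)
  simpa [sigma] using this

theorem sigma_eq (hA : A.PosDef) (G : Mat d) : sigma A G = (G * A⁻¹).trace - d := by
  rw [sigma, sub_mul, trace_sub, mul_nonsing_inv _ ((isUnit_iff_isUnit_det _).1 hA.isUnit),
    trace_one, Fintype.card_fin]

theorem sigma_le {η : ℝ} (hA : A.PosDef) (h : G ≤ η • A) : sigma A G ≤ d * (η - 1) := by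
  have := trace_mul_le_trace_mul hA.inv.posSemidef h
  rw [trace_mul_comm, mul_smul_comm, trace_smul, nonsing_inv_mul _
    ((isUnit_iff_isUnit_det _).1 hA.isUnit), trace_one, Fintype.card_fin, smul_eq_mul] at this
  rw [sigma_eq hA]
  linarith

theorem sub_le_sigma_smul (hA : A.PosDef) (h : A ≤ G) : G - A ≤ sigma A G • A :=
  le_trace_smul hA (le_iff.1 h)

/-- Effect on `sigma` of rescaling `G` by `c` when the reference matrix changes by a factor `c`. -/
theorem sigma_smul_le {B : Mat d} {y : ℝ} (hy : 0 ≤ y) (hA : A.PosDef) (hG : A ≤ G)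
    (h : A ≤ (1 + y) • B) :
    sigma B ((1 + y) • G) ≤ (1 + y) ^ 2 * (sigma A G + 2 * d * y) := by
  have hc : 0 < 1 + y := by linarith
  have hB : B.PosDef := by
    have := (posDef_of_le hA h).smul (inv_pos.2 hc)
    rwa [inv_smul_smul₀ hc.ne'] at this
  have hGp := (posDef_of_le hA hG).posSemidef
  have h1 : B⁻¹ ≤ (1 + y) • A⁻¹ := by
    have := smul_le_smul_left_of_nonneg (inv_le_inv_of_posDef hA h) hc.le
    rwa [inv_smul_of_posDef hB hc.ne', smul_inv_smul₀ hc.ne'] at this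
  have h2 := trace_mul_le_trace_mul hGp h1
  rw [mul_smul_comm, trace_smul, smul_eq_mul] at h2
  rw [sigma_eq hB, smul_mul_assoc, trace_smul, smul_eq_mul]
  have h3 : (G * A⁻¹).trace = sigma A G + d := by rw [sigma_eq hA]; ring
  rw [h3] at h2
  have h4 := mul_le_mul_of_nonneg_left h2 hc.le
  have hd : (0 : ℝ) ≤ d := Nat.cast_nonneg d
  have : (d : ℝ) * ((1 + y) ^ 2 - 1) ≤ d * (2 * y * (1 + y) ^ 2) := by
    refine mul_le_mul_of_nonneg_left ?_ hd
    nlinarith [pow_nonneg hy 2, pow_nonneg hy 3]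
  nlinarith

end Sigma

/-! ### Linearization of the gradient -/

section Gradient

variable {d : ℕ} {f : Vec d → ℝ} {μ L M : ℝ}

theorem fderiv_fderiv_apply (f : Vec d → ℝ) (x v w : Vec d) :
    fderiv ℝ (fderiv ℝ f) x v w = v.ofLp ⬝ᵥ hess f x *ᵥ w.ofLp := by
  have h : ∀ z : Vec d, z = ∑ i, z i • EuclideanSpace.single i (1 : ℝ) := fun z => by
    ext j
    simp [Pi.single_apply]
  conv_lhs => rw [h v, h w]
  simp only [map_sum, map_smul, _root_.sum_apply, _root_.smul_apply,
    smul_eq_mul, dotProduct, mulVec, hess, of_apply, Finset.mul_sum]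
  rw [Finset.sum_comm]
  exact Finset.sum_congr rfl fun i _ => Finset.sum_congr rfl fun j _ => by ring

theorem dotProduct_gradient (hf : Differentiable ℝ f) (x v : Vec d) :
    v.ofLp ⬝ᵥ (gradient f x).ofLp = fderiv ℝ f x v := by
  have := (hf x).hasGradientAt.hasFDerivAt.fderiv
  rw [this, InnerProductSpace.toDual_apply_apply, EuclideanSpace.inner_eq_star_dotProduct]
  simp

theorem StronglyConvexSmooth.posDef (hf : StronglyConvexSmooth f μ L) (x : Vec d) :
    (hess f x).PosDef :=
  posDef_of_le (PosDef.one.smul hf.pos_mu) (hf.lower x)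

/-- The remainder of the linearization of the gradient, measured in the dual local norm. -/
theorem normWrt_gradient_sub_le (hf : StronglyConvexSmooth f μ L)
    (hfM : StronglySelfConcordant f M) (x s : Vec d) :
    normWrt (hess f x)⁻¹
      (gradient f (x + s) - gradient f x - WithLp.toLp 2 (hess f x *ᵥ s.ofLp))
      ≤ M / 2 * normWrt (hess f x) s ^ 2 := by
  set H := hess f x with hH
  have hHp := hf.posDef x
  set r := normWrt H s
  have hr : 0 ≤ r := normWrt_nonneg _ _
  have hM := hfM.pos
  have key : ∀ v : Vec d, v.ofLp ⬝ᵥ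
      (gradient f (x + s) - gradient f x - WithLp.toLp 2 (H *ᵥ s.ofLp)).ofLp
      ≤ M / 2 * r ^ 2 * normWrt H v := by
    intro v
    -- No Hessian is integrated: this scalar function compares the directional derivative along the
    -- segment with its linearization plus a quadratic allowance, and its derivative is nonpositive
    -- on `(0, 1)` by self-concordance.
    have hd : ∀ t : ℝ, HasDerivAt (fun t : ℝ => fderiv ℝ f (x + t • s) v - t * (s.ofLp ⬝ᵥ H *ᵥ v.ofLp)
        - M / 2 * r ^ 2 * normWrt H v * t ^ 2)
        (s.ofLp ⬝ᵥ hess f (x + t • s) *ᵥ v.ofLp - s.ofLp ⬝ᵥ H *ᵥ v.ofLp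
          - M * r ^ 2 * normWrt H v * t) t := by
      intro t
      have h1 : HasDerivAt (fun t : ℝ => x + t • s) s t := by
        simpa using ((hasDerivAt_id t).smul_const s).const_add x
      have h2 := (hf.twice.2 (x + t • s)).hasFDerivAt.comp_hasDerivAt t h1
      have h3 := h2.clm_apply (hasDerivAt_const t v)
      have h4 := (h3.sub ((hasDerivAt_id t).mul_const (s.ofLp ⬝ᵥ H *ᵥ v.ofLp))).sub
        (((hasDerivAt_id t).pow 2).const_mul (M / 2 * r ^ 2 * normWrt H v))
      refine h4.congr_deriv ?_
      rw [fderiv_fderiv_apply, map_zero]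
      simp only [id, Nat.cast_ofNat]
      ring
    have hanti := antitoneOn_of_deriv_nonpos (convex_Icc (0 : ℝ) 1)
      (fun t _ => (hd t).continuousAt.continuousWithinAt)
      (fun t _ => (hd t).differentiableAt.differentiableWithinAt) (fun t ht => by
        rw [interior_Icc] at ht
        rw [(hd t).deriv]
        have b1 := hfM.bound x (x + t • s) x x
        have b2 := hfM.bound (x + t • s) x x x
        rw [normWrt_sub_comm] at b2
        rw [add_sub_cancel_left, normWrt_smul, abs_of_pos ht.1] at b1 b2
        have b3 : -((M * (t * r)) • H) ≤ hess f (x + t • s) - H := by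
          rw [← neg_sub H, neg_le_neg_iff]
          exact b2
        have cs := sq_dotProduct_mulVec_le
          ((hf.posDef (x + t • s)).isHermitian.sub hHp.isHermitian) b1 b3 s.ofLp v.ofLp
        have cs' : (s.ofLp ⬝ᵥ (hess f (x + t • s) - H) *ᵥ v.ofLp) ^ 2
            ≤ (M * r ^ 2 * normWrt H v * t) ^ 2 := by
          refine cs.trans_eq ?_
          have q1 : s.ofLp ⬝ᵥ H *ᵥ s.ofLp = r ^ 2 := (sq_normWrt hHp.posSemidef s).symm
          have q2 : v.ofLp ⬝ᵥ H *ᵥ v.ofLp = normWrt H v ^ 2 :=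
            (sq_normWrt hHp.posSemidef v).symm
          rw [q1, q2]
          ring
        have := (abs_le_of_sq_le_sq' cs' (mul_nonneg (mul_nonneg (by positivity)
          (normWrt_nonneg _ _)) ht.1.le)).2
        rw [sub_mulVec, dotProduct_sub] at this
        linarith)
    have h01 := hanti (Set.left_mem_Icc.2 zero_le_one) (Set.right_mem_Icc.2 zero_le_one)
      zero_le_one
    simp only [one_smul, zero_smul, add_zero] at h01
    simp only [WithLp.ofLp_sub, dotProduct_sub, dotProduct_gradient hf.twice.1]
    rw [dotProduct_mulVec_comm hHp.isHermitian]
    linarith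
  have hb : 0 ≤ M / 2 * r ^ 2 := by positivity
  refine Real.sqrt_le_iff.2 ⟨hb, dual_le_of_forall hHp (sq_nonneg _) fun v => ?_⟩
  have k1 := key (WithLp.toLp 2 v)
  have k2 := key ((-1 : ℝ) • WithLp.toLp 2 v)
  rw [normWrt_smul, abs_neg, abs_one, one_mul, neg_one_smul, WithLp.ofLp_neg, neg_dotProduct]
    at k2
  have e : v ⬝ᵥ H *ᵥ v = normWrt H (WithLp.toLp 2 v) ^ 2 := (sq_normWrt hHp.posSemidef _).symm
  rw [e, ← mul_pow]
  exact sq_le_sq' (by linarith) k1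

end Gradient

/-! ### Progress of one quasi-Newton step -/

section NewtonStep

variable {d : ℕ} {f : Vec d → ℝ} {μ L M : ℝ} {x : Vec d} {G : Mat d}

theorem newtonStep_sub (f : Vec d → ℝ) (x : Vec d) (G : Mat d) :
    newtonStep f x G - x = WithLp.toLp 2 (-(G⁻¹ *ᵥ (gradient f x).ofLp)) := by
  rw [newtonStep, sub_sub_cancel_left, WithLp.toLp_neg]

/-- With `H = ∇²f(x)`, `g = ∇f(x)` and step `s = -G⁻¹g`: `sᵀHs ≤ sᵀGs = gᵀG⁻¹g ≤ gᵀH⁻¹g`. -/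
theorem normWrt_newtonStep_le (hf : StronglyConvexSmooth f μ L) (hG : hess f x ≤ G) :
    normWrt (hess f x) (newtonStep f x G - x) ≤ lam f x := by
  have hH := hf.posDef x
  have hGp := posDef_of_le hH hG
  refine Real.sqrt_le_sqrt ?_
  rw [newtonStep_sub]
  simp only [quad, mulVec_neg, dotProduct_neg, neg_dotProduct, neg_neg]
  refine (dotProduct_mulVec_le hG _).trans ?_
  rw [mulVec_inv_mulVec hGp, dotProduct_comm]
  exact dotProduct_mulVec_le (inv_le_inv_of_posDef hH hG) _

theorem hess_le_smul_hess (hfM : StronglySelfConcordant f M)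
    (x y : Vec d) : hess f x ≤ (1 + M * normWrt (hess f x) (y - x)) • hess f y := by
  have := hfM.bound y x x y
  rw [normWrt_sub_comm, sub_le_iff_le_add] at this
  rwa [add_smul, one_smul, add_comm]

theorem hess_le_smul_hess' (hfM : StronglySelfConcordant f M)
    (x y : Vec d) : hess f y ≤ (1 + M * normWrt (hess f x) (y - x)) • hess f x := by
  have := hfM.bound x y x x
  rw [sub_le_iff_le_add] at this
  rwa [add_smul, one_smul, add_comm]

theorem lam_le_mul_normWrt (hf : StronglyConvexSmooth f μ L)
    (hfM : StronglySelfConcordant f M) (x y : Vec d) :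
    lam f y ≤ (1 + M / 2 * normWrt (hess f x) (y - x)) *
      normWrt (hess f x)⁻¹ (gradient f y) := by
  have hr := normWrt_nonneg (hess f x) (y - x)
  have hM := hfM.pos
  set r := normWrt (hess f x) (y - x) with hrdef
  have hc : 0 < 1 + M * r := by positivity
  have h := smul_le_smul_left_of_nonneg
    (inv_le_inv_of_posDef (hf.posDef x) (hess_le_smul_hess hfM x y)) hc.le
  rw [← hrdef, inv_smul_of_posDef (hf.posDef y) hc.ne', smul_inv_smul₀ hc.ne'] at h
  refine normWrt_le_of_quad_le (by positivity) ?_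
  have h2 := dotProduct_mulVec_le h (gradient f y).ofLp
  rw [smul_mulVec, dotProduct_smul, smul_eq_mul] at h2
  refine h2.trans (mul_le_mul_of_nonneg_right ?_
    (nonneg_of_posSemidef (hf.posDef x).inv.posSemidef _))
  nlinarith [sq_nonneg (M / 2 * r)]

-- Since `∇f(x) = -Gs` for the step `s`, the new gradient is the linearization remainder minus `(G -
-- ∇²f(x))s`.
theorem gradient_newtonStep (hf : StronglyConvexSmooth f μ L) (hG : hess f x ≤ G) :
    gradient f (newtonStep f x G) =
      (gradient f (x + (newtonStep f x G - x)) - gradient f x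
        - WithLp.toLp 2 (hess f x *ᵥ (newtonStep f x G - x).ofLp))
      + (-1 : ℝ) • WithLp.toLp 2 ((G - hess f x) *ᵥ (newtonStep f x G - x).ofLp) := by
  have hGp := posDef_of_le (hf.posDef x) hG
  rw [add_sub_cancel, newtonStep_sub]
  ext i
  simp [-mulVec_mulVec, sub_mulVec, mulVec_neg, mulVec_inv_mulVec hGp]

/-- The number `b` is left open: `σ` gives the superlinear estimate, `1 - η⁻¹` the linear one. -/
theorem lam_newtonStep_le (hf : StronglyConvexSmooth f μ L) (hfM : StronglySelfConcordant f M)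
    (hG : hess f x ≤ G) {b : ℝ}
    (hb : normWrt (hess f x)⁻¹
      (WithLp.toLp 2 ((G - hess f x) *ᵥ (newtonStep f x G - x).ofLp)) ≤ b * lam f x) :
    lam f (newtonStep f x G) ≤
      (1 + M / 2 * lam f x) * (b + M / 2 * lam f x) * lam f x := by
  have hr := normWrt_nonneg (hess f x) (newtonStep f x G - x)
  have hrl := normWrt_newtonStep_le hf hG
  have hM := hfM.pos
  have h1 := lam_le_mul_normWrt hf hfM x (newtonStep f x G)
  have h2 := normWrt_add_le (hf.posDef x).inv.posSemidef
    (gradient f (x + (newtonStep f x G - x)) - gradient f x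
        - WithLp.toLp 2 (hess f x *ᵥ (newtonStep f x G - x).ofLp))
    ((-1 : ℝ) • WithLp.toLp 2 ((G - hess f x) *ᵥ (newtonStep f x G - x).ofLp))
  rw [← gradient_newtonStep hf hG, normWrt_smul, abs_neg, abs_one, one_mul] at h2
  have h3 := normWrt_gradient_sub_le hf hfM x (newtonStep f x G - x)
  set r := normWrt (hess f x) (newtonStep f x G - x)
  have h4 : M / 2 * r ^ 2 ≤ M / 2 * lam f x * lam f x := by
    rw [mul_assoc, ← sq]
    gcongr
  have h0 := normWrt_nonneg (hess f x)⁻¹ (gradient f (newtonStep f x G))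
  refine h1.trans ?_
  rw [mul_assoc]
  exact mul_le_mul (by gcongr) (by linarith) h0 (by have := hr.trans hrl; positivity)

/-- Superlinear estimate for one step. -/
theorem lam_newtonStep_le_sigma (hf : StronglyConvexSmooth f μ L)
    (hfM : StronglySelfConcordant f M) (hG : hess f x ≤ G) :
    lam f (newtonStep f x G) ≤
      (1 + M / 2 * lam f x) * (sigma (hess f x) G + M / 2 * lam f x) * lam f x := by
  have hs := sigma_nonneg (hf.posDef x) hG
  refine lam_newtonStep_le hf hfM hG ((normWrt_le_of_quad_le hs ?_).trans
    (mul_le_mul_of_nonneg_left (normWrt_newtonStep_le hf hG) hs))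
  exact dual_mulVec_le (hf.posDef x) (le_iff.1 hG) hs (sub_le_sigma_smul (hf.posDef x) hG) _

/-- Linear estimate for one step. -/
theorem lam_newtonStep_le_linear (hf : StronglyConvexSmooth f μ L)
    (hfM : StronglySelfConcordant f M) (hG : hess f x ≤ G) {η : ℝ} (hη : 1 ≤ η)
    (hG' : G ≤ η • hess f x) :
    lam f (newtonStep f x G) ≤
      (1 + M / 2 * lam f x) * (1 - η⁻¹ + M / 2 * lam f x) * lam f x := by
  have hH := hf.posDef x
  have hGp := posDef_of_le hH hG
  have hη0 : 0 < η := by linarith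
  have hc : 0 ≤ 1 - η⁻¹ := sub_nonneg.2 (inv_le_one_of_one_le₀ hη)
  refine lam_newtonStep_le hf hfM hG (normWrt_le_of_quad_le hc ?_)
  have hE : G⁻¹ ≤ (hess f x)⁻¹ := inv_le_inv_of_posDef hH hG
  have hE' : (hess f x)⁻¹ - G⁻¹ ≤ (1 - η⁻¹) • (hess f x)⁻¹ := by
    have := inv_le_inv_of_posDef hGp hG'
    rw [inv_smul_of_posDef hH hη0.ne'] at this
    rw [sub_smul, one_smul]
    exact sub_le_sub_left this _
  have key := dual_mulVec_le hH.inv (le_iff.1 hE) hc hE' (gradient f x).ofLp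
  -- This rewriting replaces `G - H` by `H⁻¹ - G⁻¹`, which is at most `(1 - η⁻¹) H⁻¹`; bounding `G -
  -- H` directly would only give `η - 1`.
  have e : (G - hess f x) *ᵥ (newtonStep f x G - x).ofLp
      = -(hess f x *ᵥ (((hess f x)⁻¹ - G⁻¹) *ᵥ (gradient f x).ofLp)) := by
    rw [newtonStep_sub]
    simp only [mulVec_neg, sub_mulVec, mulVec_sub, mulVec_inv_mulVec hGp, mulVec_inv_mulVec hH]
  rw [e]
  have hdet := (isUnit_iff_isUnit_det _).1 hH.isUnit
  rw [nonsing_inv_nonsing_inv _ hdet] at key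
  simp only [quad, mulVec_neg, dotProduct_neg, neg_dotProduct, neg_neg, inv_mulVec_mulVec hH]
  rwa [dotProduct_comm]

end NewtonStep

/-! ### The correction factor and the potential -/

section OneStep

variable {d : ℕ} {f : Vec d → ℝ} {μ L M : ℝ} {x : Vec d} {G : Mat d}

/-- The corrected matrix `(1 + M r) G`, where `r` is the local length of the step from `x`. -/
noncomputable def corrected (f : Vec d → ℝ) (M : ℝ) (x : Vec d) (G : Mat d) : Mat d :=
  (1 + M * normWrt (hess f x) (newtonStep f x G - x)) • G

theorem hess_newtonStep_le_corrected (hfM : StronglySelfConcordant f M) (hG : hess f x ≤ G) :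
    hess f (newtonStep f x G) ≤ corrected f M x G := by
  have hr := normWrt_nonneg (hess f x) (newtonStep f x G - x)
  have hM := hfM.pos
  exact (hess_le_smul_hess' hfM x _).trans (smul_le_smul_left_of_nonneg hG (by positivity))

theorem corrected_le (hf : StronglyConvexSmooth f μ L) (hfM : StronglySelfConcordant f M)
    (hG : hess f x ≤ G) {η y : ℝ} (hη : 0 ≤ η) (hG' : G ≤ η • hess f x) (hy : M * lam f x ≤ y) :
    corrected f M x G ≤ (η * Real.exp (2 * y)) • hess f (newtonStep f x G) := by
  have hr := normWrt_nonneg (hess f x) (newtonStep f x G - x)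
  have hM := hfM.pos
  have hrl := mul_le_mul_of_nonneg_left (normWrt_newtonStep_le hf hG) hM.le
  have h1 := smul_le_smul_left_of_nonneg hG'
    (show 0 ≤ 1 + M * normWrt (hess f x) (newtonStep f x G - x) by positivity)
  have h2 := smul_le_smul_left_of_nonneg (hess_le_smul_hess hfM x (newtonStep f x G))
    (show 0 ≤ (1 + M * normWrt (hess f x) (newtonStep f x G - x)) * η by positivity)
  set t := M * normWrt (hess f x) (newtonStep f x G - x)
  refine h1.trans ?_
  rw [smul_smul]
  refine h2.trans ?_
  rw [smul_smul]
  refine smul_le_smul_right_of_posSemidef (hf.posDef _).posSemidef ?_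
  have ht : 0 ≤ t := mul_nonneg hM.le hr
  have e1 : 1 + t ≤ Real.exp y := by linarith [Real.add_one_le_exp y]
  -- One factor `1 + t` comes from the correction of `G`, the other from the change of Hessian.
  have e2 : (1 + t) * (1 + t) ≤ Real.exp y * Real.exp y := by gcongr
  rw [← Real.exp_add, ← two_mul] at e2
  nlinarith

theorem sigma_corrected_le (hf : StronglyConvexSmooth f μ L) (hfM : StronglySelfConcordant f M)
    (hG : hess f x ≤ G) :
    sigma (hess f (newtonStep f x G)) (corrected f M x G) ≤
      (1 + M * lam f x) ^ 2 * (sigma (hess f x) G + 2 * d * (M * lam f x)) := by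
  have hr := normWrt_nonneg (hess f x) (newtonStep f x G - x)
  have hM := hfM.pos
  have hrl := mul_le_mul_of_nonneg_left (normWrt_newtonStep_le hf hG) hM.le
  have hs := sigma_nonneg (hf.posDef x) hG
  refine (sigma_smul_le (mul_nonneg hM.le hr) (hf.posDef x) hG
    (hess_le_smul_hess hfM x _)).trans ?_
  gcongr

theorem lam_nonneg (f : Vec d → ℝ) (x : Vec d) : 0 ≤ lam f x := normWrt_nonneg _ _

/-- The potential `σ + 2 d M λ`. -/
noncomputable def potential (f : Vec d → ℝ) (M : ℝ) (x : Vec d) (G : Mat d) : ℝ :=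
  sigma (hess f x) G + 2 * d * (M * lam f x)

theorem sigma_le_potential (hM : 0 < M) : sigma (hess f x) G ≤ potential f M x G := by
  have := lam_nonneg f x
  rw [potential, le_add_iff_nonneg_right]
  positivity

theorem potential_nonneg (hf : StronglyConvexSmooth f μ L) (hM : 0 < M) (hG : hess f x ≤ G) :
    0 ≤ potential f M x G :=
  (sigma_nonneg (hf.posDef x) hG).trans (sigma_le_potential hM)

theorem lam_newtonStep_le_potential (hd : 1 ≤ d) (hf : StronglyConvexSmooth f μ L)
    (hfM : StronglySelfConcordant f M) (hG : hess f x ≤ G) :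
    lam f (newtonStep f x G) ≤ (1 + M / 2 * lam f x) * potential f M x G * lam f x := by
  have hM := hfM.pos
  have hl := lam_nonneg f x
  refine (lam_newtonStep_le_sigma hf hfM hG).trans ?_
  have h1 : (1 : ℝ) ≤ d := by exact_mod_cast hd
  have h2 := mul_le_mul_of_nonneg_right h1 (mul_nonneg hM.le hl)
  have h3 := mul_nonneg hM.le hl
  have : sigma (hess f x) G + M / 2 * lam f x ≤ potential f M x G := by
    rw [potential]
    linarith
  gcongr

end OneStep

/-! ### Deterministic linear convergence -/

section Deterministic

variable {d : ℕ} {f : Vec d → ℝ} {μ L M : ℝ} {x₀ : Vec d} {G₀ : Mat d} {η : ℝ}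
  {u : ℕ → Vec d} {τ : ℕ → ℝ}

theorem iterates_succ (f : Vec d → ℝ) (M : ℝ) (x₀ : Vec d) (G₀ : Mat d) (u : ℕ → Vec d)
    (τ : ℕ → ℝ) (k : ℕ) :
    iterates f M x₀ G₀ u τ (k + 1) =
      (newtonStep f (iterates f M x₀ G₀ u τ k).1 (iterates f M x₀ G₀ u τ k).2,
        broyd (τ k) (corrected f M (iterates f M x₀ G₀ u τ k).1 (iterates f M x₀ G₀ u τ k).2)
          (hess f (newtonStep f (iterates f M x₀ G₀ u τ k).1 (iterates f M x₀ G₀ u τ k).2))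
          (u k)) := rfl

/-- For `d ≥ 2` the left side is at most `ln 2 / 5 < 0.14`. -/
theorem four_mul_le_of_le_log_two_div (hd : 2 ≤ d) (hη : 1 ≤ η) {c : ℝ}
    (hc : c ≤ Real.log 2 / (4 * η * (2 * (d : ℝ) + 1))) : 4 * η * c ≤ 14 / 100 := by
  have hd' : (2 : ℝ) ≤ d := by exact_mod_cast hd
  have hl := Real.log_two_lt_d9
  rw [le_div_iff₀ (by positivity)] at hc
  by_contra! h
  nlinarith

theorem linear_factor_le (hη : 1 ≤ η) {c y t : ℝ} (hc : 4 * η * c ≤ 14 / 100)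
    (hy0 : 0 ≤ y) (hy : y ≤ c) (ht : t ≤ 4 * η * c) :
    (1 + y / 2) * (1 - (η * Real.exp t)⁻¹ + y / 2) ≤ 1 - 1 / (2 * η) := by
  have hη0 : 0 < η := by linarith
  have e1 : 1 - 14 / 100 ≤ (Real.exp t)⁻¹ := by
    rw [← Real.exp_neg]
    linarith [Real.add_one_le_exp (-t)]
  have hh : 0 < η⁻¹ := by positivity
  have hh1 : η⁻¹ ≤ 1 := inv_le_one_of_one_le₀ hη
  have e2 : (86 / 100) * η⁻¹ ≤ (η * Real.exp t)⁻¹ := by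
    rw [mul_inv]
    nlinarith
  have e3 : y ≤ (35 / 1000) * η⁻¹ := by
    rw [← div_eq_mul_inv, le_div_iff₀ hη0]
    nlinarith
  have e4 : 1 / (2 * η) = η⁻¹ / 2 := by
    field_simp
  rw [e4]
  nlinarith

theorem iterates_invariants (hd : 2 ≤ d) (hf : StronglyConvexSmooth f μ L)
    (hfM : StronglySelfConcordant f M) (hη : 1 ≤ η) (hG₀_lower : hess f x₀ ≤ G₀)
    (hG₀_upper : G₀ ≤ η • hess f x₀)
    (hx₀ : M * lam f x₀ ≤ Real.log 2 / (4 * η * (2 * (d : ℝ) + 1)))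
    (hτ : ∀ k, τ k ∈ Set.Icc (0 : ℝ) 1) (k : ℕ) :
    hess f (iterates f M x₀ G₀ u τ k).1 ≤ (iterates f M x₀ G₀ u τ k).2 ∧
    (iterates f M x₀ G₀ u τ k).2 ≤
      (η * Real.exp (4 * η * (M * lam f x₀) * (1 - (1 - 1 / (2 * η)) ^ k)))
        • hess f (iterates f M x₀ G₀ u τ k).1 ∧
    lam f (iterates f M x₀ G₀ u τ k).1 ≤ (1 - 1 / (2 * η)) ^ k * lam f x₀ := by
  have hM := hfM.pos
  have hη0 : 0 < η := by linarith
  have hl0 := lam_nonneg f x₀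
  have hρ1 : 1 - 1 / (2 * η) ≤ 1 := by
    have : 0 < 1 / (2 * η) := by positivity
    linarith
  have hρ0 : 0 ≤ 1 - 1 / (2 * η) := by
    rw [sub_nonneg, div_le_one (by positivity)]
    linarith
  have hsmall := four_mul_le_of_le_log_two_div hd hη hx₀
  set c := M * lam f x₀ with hcdef
  have hc0 : 0 ≤ c := by positivity
  have hρη : 2 * η * (1 - (1 - 1 / (2 * η))) = 1 := by
    field_simp
    ring
  set ρ := 1 - 1 / (2 * η) with hρdef
  induction k with
  | zero => simpa [iterates] using ⟨hG₀_lower, hG₀_upper⟩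
  | succ k ih =>
    obtain ⟨h1, h2, h3⟩ := ih
    rw [iterates_succ]
    set x := (iterates f M x₀ G₀ u τ k).1
    set G := (iterates f M x₀ G₀ u τ k).2
    have hlk := lam_nonneg f x
    have hρk0 : 0 ≤ ρ ^ k := pow_nonneg hρ0 k
    have hρk1 : ρ ^ k ≤ 1 := pow_le_one₀ hρ0 hρ1
    have hMl : M * lam f x ≤ ρ ^ k * c := by
      have := mul_le_mul_of_nonneg_left h3 hM.le
      rw [hcdef]
      linarith
    have ht0 : 0 ≤ 4 * η * c * (1 - ρ ^ k) :=
      mul_nonneg (by positivity) (sub_nonneg.2 hρk1)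
    have ht1 : 4 * η * c * (1 - ρ ^ k) ≤ 4 * η * c :=
      mul_le_of_le_one_right (by positivity) (by linarith)
    have hη1 : 1 ≤ η * Real.exp (4 * η * c * (1 - ρ ^ k)) :=
      one_le_mul_of_one_le_of_one_le hη (Real.one_le_exp ht0)
    have hlow := hess_newtonStep_le_corrected hfM h1
    -- The exponent is `2c` times the partial geometric sum of `ρ`; one more term fits because `2η(1
    -- - ρ) = 1`.
    have hexp : η * Real.exp (4 * η * c * (1 - ρ ^ k)) * Real.exp (2 * (ρ ^ k * c))
        = η * Real.exp (4 * η * c * (1 - ρ ^ (k + 1))) := by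
      rw [mul_assoc, ← Real.exp_add]
      congr 2
      rw [pow_succ]
      linear_combination (-2 * c * ρ ^ k) * hρη
    have hup := corrected_le hf hfM h1 (by linarith) h2 hMl
    rw [hexp] at hup
    refine ⟨le_broyd (hτ k) (hf.posDef _) hlow _, broyd_le (hτ k) ?_ (hf.posDef _) hlow hup _, ?_⟩
    · refine one_le_mul_of_one_le_of_one_le hη (Real.one_le_exp ?_)
      exact mul_nonneg (by positivity) (sub_nonneg.2 (pow_le_one₀ hρ0 hρ1))
    · refine (lam_newtonStep_le_linear hf hfM h1 hη1 h2).trans ?_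
      have := linear_factor_le (y := M * lam f x) hη hsmall (mul_nonneg hM.le hlk)
        (hMl.trans (mul_le_of_le_one_left hc0 hρk1)) ht1
      rw [pow_succ', mul_assoc ρ]
      refine mul_le_mul (le_of_eq_of_le ?_ this) h3 hlk hρ0
      ring

end Deterministic

/-! ### Measurability of the ingredients -/

section Measurability

variable {α : Type*} {m : MeasurableSpace α} {d : ℕ}

/-- Entrywise measurability of a matrix-valued function. -/
def MeasurableMat [MeasurableSpace α] (A : α → Mat d) : Prop :=
  ∀ i j, Measurable fun a => A a i j

namespace MeasurableMat

variable {A B : α → Mat d} {v w : α → Fin d → ℝ} {c : α → ℝ}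

theorem add (hA : MeasurableMat A) (hB : MeasurableMat B) :
    MeasurableMat fun a => A a + B a := fun i j => (hA i j).add (hB i j)

theorem sub (hA : MeasurableMat A) (hB : MeasurableMat B) :
    MeasurableMat fun a => A a - B a := fun i j => (hA i j).sub (hB i j)

theorem smul (hc : Measurable c) (hA : MeasurableMat A) :
    MeasurableMat fun a => c a • A a := fun i j => hc.mul (hA i j)

theorem mul (hA : MeasurableMat A) (hB : MeasurableMat B) :
    MeasurableMat fun a => A a * B a := fun i j => by
  simp only [mul_apply]
  exact Finset.measurable_fun_sum _ fun k _ => (hA i k).mul (hB k j)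

theorem trace (hA : MeasurableMat A) : Measurable fun a => (A a).trace := by
  simp only [Matrix.trace, diag_apply]
  exact Finset.measurable_fun_sum _ fun k _ => hA k k

theorem det (hA : MeasurableMat A) : Measurable fun a => (A a).det := by
  simp only [det_apply, zsmul_eq_mul, Units.smul_def]
  exact Finset.measurable_fun_sum _ fun σ _ =>
    (Finset.measurable_fun_prod _ fun i _ => hA _ _).const_mul _

theorem inv (hA : MeasurableMat A) : MeasurableMat fun a => (A a)⁻¹ := by
  have hadj : MeasurableMat fun a => (A a).adjugate := fun i j => by
    simp only [adjugate_apply]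
    refine det fun k l => ?_
    by_cases h : k = j
    · subst h
      simp only [updateRow_self]
      exact measurable_const
    · simp only [updateRow_ne h]
      exact hA k l
  simp only [inv_def, Ring.inverse_eq_inv']
  exact smul hA.det.inv hadj

theorem mulVec (hA : MeasurableMat A) (hv : Measurable v) : Measurable fun a => A a *ᵥ v a := by
  refine measurable_pi_iff.2 fun i => ?_
  simp only [Matrix.mulVec, dotProduct]
  exact Finset.measurable_fun_sum _ fun j _ => (hA i j).mul ((measurable_pi_apply j).comp hv)

theorem vecMulVec (hv : Measurable v) (hw : Measurable w) :
    MeasurableMat fun a => Matrix.vecMulVec (v a) (w a) := fun i j =>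
  ((measurable_pi_apply i).comp hv).mul ((measurable_pi_apply j).comp hw)

end MeasurableMat

theorem measurable_dotProduct {v w : α → Fin d → ℝ} (hv : Measurable v) (hw : Measurable w) :
    Measurable fun a => v a ⬝ᵥ w a := by
  simp only [dotProduct]
  exact Finset.measurable_fun_sum _ fun j _ =>
    ((measurable_pi_apply j).comp hv).mul ((measurable_pi_apply j).comp hw)

variable {A G : α → Mat d} {x u : α → Vec d} {τ : α → ℝ} {f : Vec d → ℝ} {M : ℝ}

theorem measurable_ofLp (hu : Measurable u) : Measurable fun a => (u a).ofLp :=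
  (WithLp.measurable_ofLp 2 _).comp hu

theorem measurable_quad (hA : MeasurableMat A) (hu : Measurable u) :
    Measurable fun a => quad (A a) (u a) :=
  measurable_dotProduct (measurable_ofLp hu) (hA.mulVec (measurable_ofLp hu))

theorem measurable_normWrt (hA : MeasurableMat A) (hu : Measurable u) :
    Measurable fun a => normWrt (A a) (u a) := (measurable_quad hA hu).sqrt

/-- No continuity of the second derivative is needed: derivatives are measurable. -/
theorem measurableMat_hess (f : Vec d → ℝ) (hx : Measurable x) :
    MeasurableMat fun a => hess f (x a) := fun _ _ =>
  ((ContinuousLinearMap.measurable_apply _).comp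
    (measurable_fderiv_apply_const ℝ (fderiv ℝ f) _)).comp hx

theorem measurable_gradient (hf : TwiceDifferentiable f) (hx : Measurable x) :
    Measurable fun a => gradient f (x a) :=
  ((InnerProductSpace.toDual ℝ (Vec d)).symm.continuous.comp hf.2.continuous).measurable.comp hx

theorem measurable_newtonStep (hf : TwiceDifferentiable f) (hx : Measurable x)
    (hG : MeasurableMat G) : Measurable fun a => newtonStep f (x a) (G a) :=
  hx.sub ((WithLp.measurable_toLp 2 _).comp
    (hG.inv.mulVec (measurable_ofLp (measurable_gradient hf hx))))

theorem measurable_lam (hf : TwiceDifferentiable f) (hx : Measurable x) :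
    Measurable fun a => lam f (x a) :=
  measurable_normWrt (measurableMat_hess f hx).inv (measurable_gradient hf hx)

theorem measurable_sigma (hA : MeasurableMat A) (hG : MeasurableMat G) :
    Measurable fun a => sigma (A a) (G a) := ((hG.sub hA).mul hA.inv).trace

theorem measurable_potential (hf : TwiceDifferentiable f) (hx : Measurable x)
    (hG : MeasurableMat G) : Measurable fun a => potential f M (x a) (G a) :=
  (measurable_sigma (measurableMat_hess f hx) hG).add
    (((measurable_lam hf hx).const_mul M).const_mul _)

theorem measurableMat_corrected (hf : TwiceDifferentiable f) (hx : Measurable x)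
    (hG : MeasurableMat G) : MeasurableMat fun a => corrected f M (x a) (G a) :=
  MeasurableMat.smul (((measurable_normWrt (measurableMat_hess f hx)
    ((measurable_newtonStep hf hx hG).sub hx)).const_mul M).const_add 1) hG

theorem measurableMat_broyd (hτ : Measurable τ) (hG : MeasurableMat G) (hA : MeasurableMat A)
    (hu : Measurable u) : MeasurableMat fun a => broyd (τ a) (G a) (A a) (u a) := by
  have hu' := measurable_ofLp hu
  have huu := MeasurableMat.vecMulVec hu' hu'
  have hqA := measurable_quad hA hu
  have hdfp : MeasurableMat fun a => dfp (G a) (A a) (u a) :=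
    (hG.sub (MeasurableMat.smul hqA.inv (((hA.mul huu).mul hG).add ((hG.mul huu).mul hA)))).add
      (MeasurableMat.smul ((((measurable_quad hG hu).div hqA).add_const 1).mul hqA.inv)
        ((hA.mul huu).mul hA))
  have hsr1 : MeasurableMat fun a => sr1 (G a) (A a) (u a) :=
    hG.sub (MeasurableMat.smul (measurable_quad (hG.sub hA) hu).inv
      (((hG.sub hA).mul huu).mul (hG.sub hA)))
  have hcomb := (MeasurableMat.smul hτ hdfp).add (MeasurableMat.smul (hτ.const_sub 1) hsr1)
  intro i j
  have hset : MeasurableSet {a | G a *ᵥ (u a).ofLp = A a *ᵥ (u a).ofLp} :=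
    measurableSet_eq_fun (hG.mulVec hu') (hA.mulVec hu')
  classical
  have e : (fun a => broyd (τ a) (G a) (A a) (u a) i j) =
      fun a => if G a *ᵥ (u a).ofLp = A a *ᵥ (u a).ofLp then G a i j else
        (τ a • dfp (G a) (A a) (u a) + (1 - τ a) • sr1 (G a) (A a) (u a)) i j := by
    funext a
    split_ifs with h
    · rw [broyd_of_eq _ h]
    · rw [broyd_of_ne _ h]
  rw [e]
  exact Measurable.ite hset (hG i j) (hcomb i j)

end Measurability

/-! ### Adaptedness of the iterates -/

section IteratesMeasurability

variable {d : ℕ} {f : Vec d → ℝ} {Ω : Type*} {m : MeasurableSpace Ω} {P : Measure Ω}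
  {ℱ : Filtration ℕ m} {D : Measure (Vec d)} {u : ℕ → Ω → Vec d} {τ : ℕ → Ω → ℝ}

/-- Iterate `k` uses only the choices before `u_k`, so it is independent of `u_k`. -/
theorem RandomChoices.measurable_iterates (h : RandomChoices P ℱ D u τ)
    (hf : TwiceDifferentiable f) (M : ℝ) (x₀ : Vec d) (G₀ : Mat d) (k : ℕ) :
    Measurable[ℱ k] (fun ω => (iterates f M x₀ G₀ (fun i => u i ω) (fun i => τ i ω) k).1) ∧
    @MeasurableMat Ω d (ℱ k)
      (fun ω => (iterates f M x₀ G₀ (fun i => u i ω) (fun i => τ i ω) k).2) := by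
  induction k with
  | zero => exact ⟨measurable_const, fun i j => measurable_const⟩
  | succ k ih =>
    have hle := ℱ.mono (Nat.le_succ k)
    have hx := ih.1.mono hle le_rfl
    have hG : @MeasurableMat Ω d (ℱ (k + 1)) _ := fun i j => (ih.2 i j).mono hle le_rfl
    have hx' := measurable_newtonStep hf hx hG
    exact ⟨hx', measurableMat_broyd (h.meas_tau k) (measurableMat_corrected hf hx hG)
      (measurableMat_hess f hx') (h.meas_u k)⟩

end IteratesMeasurability

/-! ### Averaging over an isotropic direction -/

section Expectation

variable {d : ℕ}

theorem abs_apply_le {B : Mat d} {C : ℝ} (hC : 0 ≤ C) (hB : B.PosSemidef) (h : B ≤ C • 1)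
    (i j : Fin d) : |B i j| ≤ C := by
  have h2 : -(C • (1 : Mat d)) ≤ B := by
    rw [le_iff, sub_neg_eq_add]
    exact hB.add (PosSemidef.one.smul hC)
  have := sq_dotProduct_mulVec_le hB.isHermitian h h2 (Pi.single i 1) (Pi.single j 1)
  simp only [single_one_dotProduct, mulVec_single_one, col_apply, one_apply_eq, mul_one] at this
  rw [← sq] at this
  exact abs_le_of_sq_le_sq this hC

theorem quad_le_of_le_smul_one {A : Mat d} {L : ℝ} (h : A ≤ L • 1) (u : Vec d) :
    quad A u ≤ L * (u.ofLp ⬝ᵥ u.ofLp) := by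
  simpa [quad, smul_mulVec] using dotProduct_mulVec_le h u.ofLp

/-- Replaces the denominator `uᵀAu` by `uᵀu`, the one in the isotropy condition, at the price of
`L`. -/
theorem quad_div_le {A B : Mat d} {L : ℝ} (hA : A.PosDef) (hAL : A ≤ L • 1)
    (hB : B.PosSemidef) (u : Vec d) :
    L⁻¹ * (quad B u / (u.ofLp ⬝ᵥ u.ofLp)) ≤ quad B u / quad A u := by
  by_cases hu : u.ofLp = 0
  · simp [quad, hu]
  · have h1 := quad_pos hA hu
    have h2 := quad_le_of_le_smul_one hAL u
    rw [← div_eq_inv_mul, div_div, mul_comm _ L]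
    exact div_le_div_of_nonneg_left (quad_nonneg hB u) h1 h2

theorem abs_mul_div_dotProduct_le_one (v : Fin d → ℝ) (i j : Fin d) :
    |v i * v j / (v ⬝ᵥ v)| ≤ 1 := by
  have hk : ∀ k, v k ^ 2 ≤ v ⬝ᵥ v := fun k => by
    rw [dotProduct, sq]
    exact Finset.single_le_sum (f := fun k => v k * v k) (fun l _ => mul_self_nonneg _)
      (Finset.mem_univ k)
  have h0 : 0 ≤ v ⬝ᵥ v := (sq_nonneg (v i)).trans (hk i)
  rw [abs_div, abs_of_nonneg h0]
  refine div_le_one_of_le₀ (abs_le_of_sq_le_sq ?_ h0) h0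
  rw [mul_pow, sq (v ⬝ᵥ v)]
  exact mul_le_mul (hk i) (hk j) (sq_nonneg _) h0

theorem quad_div_eq_sum (B : Mat d) (u : Vec d) :
    quad B u / (u.ofLp ⬝ᵥ u.ofLp) =
      ∑ i, ∑ j, B i j * (u i * u j / (u.ofLp ⬝ᵥ u.ofLp)) := by
  simp only [quad, mulVec, dotProduct, Finset.sum_div, Finset.mul_sum]
  exact Finset.sum_congr rfl fun i _ => Finset.sum_congr rfl fun j _ => by ring

variable {Ω : Type*} {𝓖 m : MeasurableSpace Ω} {P : Measure Ω} [IsProbabilityMeasure P]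

theorem integrable_of_abs_le {X : Ω → ℝ} (hX : Measurable X) {C : ℝ} (h : ∀ ω, |X ω| ≤ C) :
    Integrable X P :=
  Integrable.of_bound hX.aestronglyMeasurable C (Filter.Eventually.of_forall h)

theorem measurable_mul_div_dotProduct (i j : Fin d) :
    Measurable fun v : Vec d => v i * v j / (v.ofLp ⬝ᵥ v.ofLp) :=
  ((((measurable_pi_apply i).comp (measurable_ofLp measurable_id)).mul
    ((measurable_pi_apply j).comp (measurable_ofLp measurable_id)))).div
    (measurable_dotProduct (measurable_ofLp measurable_id) (measurable_ofLp measurable_id))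

/-- The expected value of `uᵀ B u / uᵀ u` for an isotropic direction `u` independent of `B`. -/
theorem integral_quad_div {D : Measure (Vec d)} (hD : IsotropicDirections D)
    (h𝓖 : 𝓖 ≤ m) {u : Ω → Vec d} (hu : Measurable u)
    (hind : Indep (MeasurableSpace.comap u inferInstance) 𝓖 P) (hlaw : P.map u = D)
    {B : Ω → Mat d} (hB : @MeasurableMat Ω d 𝓖 B) {C : ℝ} (hC : ∀ ω i j, |B ω i j| ≤ C) :
    Integrable (fun ω => quad (B ω) (u ω) / ((u ω).ofLp ⬝ᵥ (u ω).ofLp)) P ∧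
    ∫ ω, quad (B ω) (u ω) / ((u ω).ofLp ⬝ᵥ (u ω).ofLp) ∂P = (d : ℝ)⁻¹ * ∫ ω, (B ω).trace ∂P := by
  simp only [quad_div_eq_sum]
  have hBi : ∀ i j, Integrable (fun ω => B ω i j) P := fun i j =>
    integrable_of_abs_le ((hB i j).mono h𝓖 le_rfl) fun ω => hC ω i j
  have hg := fun i j => (measurable_mul_div_dotProduct (d := d) i j).comp hu
  have hgi : ∀ i j, Integrable
      ((fun v : Vec d => v i * v j / (v.ofLp ⬝ᵥ v.ofLp)) ∘ u) P := fun i j =>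
    integrable_of_abs_le (hg i j) fun ω => abs_mul_div_dotProduct_le_one _ i j
  -- Entrywise independence lets each expectation factor; isotropy then leaves only the diagonal of
  -- `B`.
  have hI : ∀ i j, IndepFun (fun ω => B ω i j)
      ((fun v : Vec d => v i * v j / (v.ofLp ⬝ᵥ v.ofLp)) ∘ u) P := fun i j => by
    rw [IndepFun_iff_Indep]
    refine indep_of_indep_of_le_left (indep_of_indep_of_le_right hind.symm ?_) (hB i j).comap_le
    rw [← MeasurableSpace.comap_comp]
    exact MeasurableSpace.comap_mono (measurable_mul_div_dotProduct i j).comap_le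
  have hint : ∀ i j, Integrable (fun ω => B ω i j *
      (u ω i * u ω j / ((u ω).ofLp ⬝ᵥ (u ω).ofLp))) P := fun i j =>
    (hI i j).integrable_mul (hBi i j) (hgi i j)
  refine ⟨integrable_finsetSum _ fun i _ => integrable_finsetSum _ fun j _ => hint i j, ?_⟩
  rw [integral_finsetSum _ fun i _ => integrable_finsetSum _ fun j _ => hint i j]
  simp only [Matrix.trace, diag_apply]
  rw [integral_finsetSum _ fun i _ => hBi i i, Finset.mul_sum]
  refine Finset.sum_congr rfl fun i _ => ?_
  rw [integral_finsetSum _ fun j _ => hint i j]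
  have hij : ∀ j, ∫ ω, B ω i j * (u ω i * u ω j / ((u ω).ofLp ⬝ᵥ (u ω).ofLp)) ∂P
      = (∫ ω, B ω i j ∂P) * ((1 / (d : ℝ)) • (1 : Mat d)) i j := fun j => by
    rw [← hD i j, ← hlaw, integral_map hu.aemeasurable
      (measurable_mul_div_dotProduct i j).aestronglyMeasurable]
    exact (hI i j).integral_fun_mul_eq_mul_integral (hBi i j).1 (hgi i j).1
  simp only [hij, Matrix.smul_apply, smul_eq_mul, one_apply]
  simp [mul_comm]

/-- Averaging the guaranteed decrease of `sigma` over an isotropic direction. -/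
theorem integral_sigma_broyd_le {D : Measure (Vec d)} (hD : IsotropicDirections D)
    (h𝓖 : 𝓖 ≤ m) {u : Ω → Vec d} (hu : Measurable u)
    (hind : Indep (MeasurableSpace.comap u inferInstance) 𝓖 P) (hlaw : P.map u = D)
    {A G : Ω → Mat d} (hA : @MeasurableMat Ω d 𝓖 A) (hG : @MeasurableMat Ω d 𝓖 G)
    {μ L C : ℝ} (hμ : 0 < μ) (hL : 0 < L) (hC : 0 ≤ C) (hAμ : ∀ ω, μ • (1 : Mat d) ≤ A ω)
    (hAL : ∀ ω, A ω ≤ L • (1 : Mat d)) (hAG : ∀ ω, A ω ≤ G ω) (hGC : ∀ ω, G ω - A ω ≤ C • (1 : Mat d))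
    {τ : Ω → ℝ} (hτm : Measurable τ) (hτ : ∀ ω, τ ω ∈ Set.Icc (0 : ℝ) 1) :
    Integrable (fun ω => sigma (A ω) (G ω)) P ∧
    Integrable (fun ω => sigma (A ω) (broyd (τ ω) (G ω) (A ω) (u ω))) P ∧
    ∫ ω, sigma (A ω) (broyd (τ ω) (G ω) (A ω) (u ω)) ∂P ≤
      (1 - 1 / (d * (L / μ))) * ∫ ω, sigma (A ω) (G ω) ∂P := by
  have hpd : ∀ ω, (A ω).PosDef := fun ω => posDef_of_le (PosDef.one.smul hμ) (hAμ ω)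
  have hE : ∀ ω, (G ω - A ω).PosSemidef := fun ω => le_iff.1 (hAG ω)
  have hA' : MeasurableMat A := fun i j => (hA i j).mono h𝓖 le_rfl
  have hG' : MeasurableMat G := fun i j => (hG i j).mono h𝓖 le_rfl
  have hent : ∀ ω i j, |(G ω - A ω) i j| ≤ C := fun ω => abs_apply_le hC (hE ω) (hGC ω)
  obtain ⟨hq, hqi⟩ := integral_quad_div hD h𝓖 hu hind hlaw (hG.sub hA) hent
  have hst : ∀ ω, sigma (A ω) (G ω) ≤ μ⁻¹ * (G ω - A ω).trace := fun ω => by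
    have := trace_mul_le_trace_mul (hE ω) (inv_le_smul_one hμ (hAμ ω))
    rwa [mul_smul_comm, mul_one, trace_smul, smul_eq_mul] at this
  have htr : ∀ ω, (G ω - A ω).trace ≤ d * C := fun ω => by
    have : (G ω - A ω).trace ≤ ∑ _i : Fin d, C :=
      Finset.sum_le_sum fun i _ => (le_abs_self _).trans (hent ω i i)
    simpa using this
  have hs0 : ∀ ω, 0 ≤ sigma (A ω) (G ω) := fun ω => sigma_nonneg (hpd ω) (hAG ω)
  have hsi : Integrable (fun ω => sigma (A ω) (G ω)) P :=
    integrable_of_abs_le (measurable_sigma hA' hG') (C := μ⁻¹ * (d * C)) fun ω => by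
      rw [abs_of_nonneg (hs0 ω)]
      exact (hst ω).trans (mul_le_mul_of_nonneg_left (htr ω) (by positivity))
  have hti : Integrable (fun ω => (G ω - A ω).trace) P :=
    integrable_of_abs_le (hG'.sub hA').trace (C := d * C) fun ω => by
      rw [abs_of_nonneg (hE ω).trace_nonneg]
      exact htr ω
  -- The guaranteed decrease does not involve `τ`, so `τ` may depend on `u`.
  have hdec : ∀ ω, sigma (A ω) (broyd (τ ω) (G ω) (A ω) (u ω)) ≤ sigma (A ω) (G ω)
      - L⁻¹ * (quad (G ω - A ω) (u ω) / ((u ω).ofLp ⬝ᵥ (u ω).ofLp)) := fun ω =>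
    (sigma_broyd_le (hτ ω) (hpd ω) (hAG ω) (u ω)).trans
      (sub_le_sub_left (quad_div_le (hpd ω) (hAL ω) (hE ω) (u ω)) _)
  have hb0 : ∀ ω, 0 ≤ sigma (A ω) (broyd (τ ω) (G ω) (A ω) (u ω)) := fun ω =>
    sigma_nonneg (hpd ω) (le_broyd (hτ ω) (hpd ω) (hAG ω) (u ω))
  have hbi : Integrable (fun ω => sigma (A ω) (broyd (τ ω) (G ω) (A ω) (u ω))) P := by
    refine hsi.mono' (measurable_sigma hA'
      (measurableMat_broyd hτm hG' hA' hu)).aestronglyMeasurable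
      (Filter.Eventually.of_forall fun ω => ?_)
    rw [Real.norm_of_nonneg (hb0 ω)]
    refine (sigma_broyd_le (hτ ω) (hpd ω) (hAG ω) (u ω)).trans (sub_le_self _ ?_)
    exact div_nonneg (quad_nonneg (hE ω) _) (quad_nonneg (hpd ω).posSemidef _)
  refine ⟨hsi, hbi, ?_⟩
  have h1 := integral_mono hbi (hsi.sub (hq.const_mul L⁻¹)) hdec
  simp only [Pi.sub_apply] at h1
  rw [integral_sub hsi (hq.const_mul L⁻¹), integral_const_mul, hqi] at h1
  have h2 := integral_mono hsi (hti.const_mul μ⁻¹) hst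
  rw [integral_const_mul] at h2
  refine h1.trans ?_
  have h3 : μ * ∫ ω, sigma (A ω) (G ω) ∂P ≤ ∫ ω, (G ω - A ω).trace ∂P := by
    rwa [← div_eq_inv_mul, le_div_iff₀' hμ] at h2
  have h4 := mul_le_mul_of_nonneg_left h3 (show 0 ≤ L⁻¹ * (d : ℝ)⁻¹ by positivity)
  have h5 : 1 / (d * (L / μ)) = L⁻¹ * (d : ℝ)⁻¹ * μ := by
    rw [one_div, mul_inv, inv_div]
    ring
  rw [h5]
  linarith

end Expectation

/-! ### Decay of the expected potential and tail bounds -/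

section Random

variable {d : ℕ} {f : Vec d → ℝ} {μ L M : ℝ} {x₀ : Vec d} {G₀ : Mat d} {η : ℝ}
  {D : Measure (Vec d)} {Ω : Type*} {m : MeasurableSpace Ω} {P : Measure Ω}
  {ℱ : Filtration ℕ m} {u : ℕ → Ω → Vec d} {τ : ℕ → Ω → ℝ}

/-- The potential after `k` steps, as a random variable. -/
noncomputable def potentialSeq (f : Vec d → ℝ) (M : ℝ) (x₀ : Vec d) (G₀ : Mat d)
    (u : ℕ → Ω → Vec d) (τ : ℕ → Ω → ℝ) (k : ℕ) (ω : Ω) : ℝ :=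
  potential f M (iterates f M x₀ G₀ (fun i => u i ω) (fun i => τ i ω) k).1
    (iterates f M x₀ G₀ (fun i => u i ω) (fun i => τ i ω) k).2

theorem one_sub_one_div_mem (hη : 1 ≤ η) :
    0 ≤ 1 - 1 / (2 * η) ∧ 1 - 1 / (2 * η) ≤ 1 := by
  have h : 0 < 1 / (2 * η) := by positivity
  have h' : 1 / (2 * η) ≤ 1 := by
    rw [div_le_one (by positivity)]
    linarith
  constructor <;> linarith

/-- Absorbs the `λ` part of the new potential into the contraction: `1 - 1/n ≥ 1/2` gives `2ay ≤ (1
- 1/n) 4ay`, and `1 + z ≤ exp z` does the rest. -/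
theorem contraction_factor_le {n y a : ℝ} (hn : 2 ≤ n) (hy : 0 ≤ y) (ha : 0 ≤ a) :
    (1 - 1 / n) * (1 + y) ^ 2 + 2 * a * y * (1 + y) ^ 2 ≤
      (1 - 1 / n) * Real.exp ((4 * a + 2) * y) := by
  have h1 : 1 / 2 ≤ 1 - 1 / n := by
    have : 1 / n ≤ 1 / 2 := one_div_le_one_div_of_le (by norm_num) hn
    linarith
  have h2 : 2 * a * y ≤ (1 - 1 / n) * (4 * a * y) := by
    nlinarith [mul_nonneg ha hy]
  have e1 : (1 + y) ^ 2 ≤ Real.exp (2 * y) := by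
    have := pow_le_pow_left₀ (by linarith) (Real.add_one_le_exp y) 2
    rwa [← Real.exp_nat_mul, add_comm y] at this
  have e2 : 1 + 4 * a * y ≤ Real.exp (4 * a * y) := by
    linarith [Real.add_one_le_exp (4 * a * y)]
  have e3 : (1 + y) ^ 2 * (1 + 4 * a * y) ≤ Real.exp ((4 * a + 2) * y) := by
    refine (mul_le_mul e1 e2 (by positivity) (Real.exp_nonneg _)).trans_eq ?_
    rw [← Real.exp_add]
    ring_nf
  calc (1 - 1 / n) * (1 + y) ^ 2 + 2 * a * y * (1 + y) ^ 2
      ≤ (1 - 1 / n) * (1 + y) ^ 2 + (1 - 1 / n) * (4 * a * y) * (1 + y) ^ 2 := by gcongr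
    _ = (1 - 1 / n) * ((1 + y) ^ 2 * (1 + 4 * a * y)) := by ring
    _ ≤ _ := mul_le_mul_of_nonneg_left e3 (by linarith)

theorem StronglyConvexSmooth.mu_le (hd : 0 < d) (hf : StronglyConvexSmooth f μ L) : μ ≤ L := by
  have h := dotProduct_mulVec_le ((hf.lower 0).trans (hf.upper 0)) (Pi.single (⟨0, hd⟩ : Fin d) 1)
  simpa [smul_mulVec] using h

theorem two_le_dim_mul_cond (hd : 2 ≤ d) (hf : StronglyConvexSmooth f μ L) :
    2 ≤ (d : ℝ) * (L / μ) := by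
  have h1 : (2 : ℝ) ≤ d := by exact_mod_cast hd
  have h2 : 1 ≤ L / μ := (one_le_div hf.pos_mu).2 (hf.mu_le (by omega))
  nlinarith

theorem integral_potentialSeq_succ_le [IsProbabilityMeasure P] (hd : 2 ≤ d)
    (hf : StronglyConvexSmooth f μ L) (hfM : StronglySelfConcordant f M) (hη : 1 ≤ η)
    (hG₀_lower : hess f x₀ ≤ G₀) (hG₀_upper : G₀ ≤ η • hess f x₀)
    (hx₀ : M * lam f x₀ ≤ Real.log 2 / (4 * η * (2 * (d : ℝ) + 1)))
    (hD : IsotropicDirections D) (hchoice : RandomChoices P ℱ D u τ)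
    (k : ℕ) (hint : Integrable (potentialSeq f M x₀ G₀ u τ k) P) :
    Integrable (potentialSeq f M x₀ G₀ u τ (k + 1)) P ∧
    ∫ ω, potentialSeq f M x₀ G₀ u τ (k + 1) ω ∂P ≤
      (1 - 1 / (d * (L / μ))) *
        Real.exp ((4 * d + 2) * ((1 - 1 / (2 * η)) ^ k * (M * lam f x₀))) *
        ∫ ω, potentialSeq f M x₀ G₀ u τ k ω ∂P := by
  obtain ⟨hρ0, hρ1⟩ := one_sub_one_div_mem hη
  have hM := hfM.pos
  have hL := hf.pos_L
  have hinv := fun ω => iterates_invariants hd hf hfM hη hG₀_lower hG₀_upper hx₀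
    (u := fun i => u i ω) (τ := fun i => τ i ω) (fun i => hchoice.tau_mem i ω)
  have hmeas := hchoice.measurable_iterates hf.twice M x₀ G₀ k
  have hmeas' := hchoice.measurable_iterates hf.twice M x₀ G₀ (k + 1)
  -- The point `x_{k+1}` is known before `u_k` is drawn, so both matrices entering the update are
  -- independent of `u_k`.
  have hx' := measurable_newtonStep hf.twice hmeas.1 hmeas.2
  -- A deterministic bound on `M λ_k`, which can therefore be pulled out of the expectations.
  set y := (1 - 1 / (2 * η)) ^ k * (M * lam f x₀) with hydef
  set K := η * Real.exp (4 * η * (M * lam f x₀) * (1 - (1 - 1 / (2 * η)) ^ k)) with hK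
  have hK0 : 0 ≤ K := by positivity
  have hl0 := lam_nonneg f x₀
  have hy0 : 0 ≤ y := by positivity
  have hMl : ∀ ω, M * lam f (iterates f M x₀ G₀ (fun i => u i ω) (fun i => τ i ω) k).1 ≤ y :=
    fun ω => by
      have := mul_le_mul_of_nonneg_left (hinv ω k).2.2 hM.le
      rw [hydef]
      linarith
  -- The constant `C` serves only for integrability.
  obtain ⟨hs, hb, hle⟩ := integral_sigma_broyd_le (C := K * Real.exp (2 * y) * L) hD (ℱ.le k)
    ((hchoice.meas_u k).mono (ℱ.le (k + 1)) le_rfl) (hchoice.indep_u k) (hchoice.law_u k)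
    (measurableMat_hess f hx') (measurableMat_corrected (M := M) hf.twice hmeas.1 hmeas.2)
    hf.pos_mu hf.pos_L (by positivity) (fun ω => hf.lower _) (fun ω => hf.upper _)
    (fun ω => hess_newtonStep_le_corrected hfM (hinv ω k).1)
    (fun ω => by
      refine (sub_le_self _ (nonneg_iff_posSemidef.2 (hf.posDef _).posSemidef)).trans ?_
      refine (corrected_le hf hfM (hinv ω k).1 hK0 (hinv ω k).2.1 (hMl ω)).trans ?_
      rw [mul_smul _ L]
      exact smul_le_smul_left_of_nonneg (hf.upper _) (by positivity))
    ((hchoice.meas_tau k).mono (ℱ.le (k + 1)) le_rfl) (hchoice.tau_mem k)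
  have hp0 : ∀ ω, 0 ≤ potentialSeq f M x₀ G₀ u τ k ω := fun ω =>
    potential_nonneg hf hM (hinv ω k).1
  have hstep : ∀ ω, potentialSeq f M x₀ G₀ u τ (k + 1) ω ≤
      sigma (hess f (iterates f M x₀ G₀ (fun i => u i ω) (fun i => τ i ω) (k + 1)).1)
        (iterates f M x₀ G₀ (fun i => u i ω) (fun i => τ i ω) (k + 1)).2
      + 2 * d * y * (1 + y) ^ 2 * potentialSeq f M x₀ G₀ u τ k ω := fun ω => by
    have h1 := lam_newtonStep_le_potential (by omega) hf hfM (hinv ω k).1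
    have h2 := hMl ω
    have h3 := lam_nonneg f (iterates f M x₀ G₀ (fun i => u i ω) (fun i => τ i ω) k).1
    have h4 := mul_le_mul_of_nonneg_left h1 hM.le
    have h5 := hp0 ω
    rw [potentialSeq] at h5 ⊢
    rw [potential, iterates_succ]
    rw [potentialSeq]
    refine add_le_add_right ?_ _
    set l := lam f (iterates f M x₀ G₀ (fun i => u i ω) (fun i => τ i ω) k).1
    set p := potential f M (iterates f M x₀ G₀ (fun i => u i ω) (fun i => τ i ω) k).1
      (iterates f M x₀ G₀ (fun i => u i ω) (fun i => τ i ω) k).2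
    have hMl0 := mul_nonneg hM.le h3
    have h6 : 1 + M / 2 * l ≤ (1 + y) ^ 2 := by nlinarith
    rw [mul_assoc (2 * (d : ℝ)), mul_assoc (2 * (d : ℝ))]
    refine mul_le_mul_of_nonneg_left (h4.trans ?_) (by positivity)
    calc M * ((1 + M / 2 * l) * p * l) = M * l * (1 + M / 2 * l) * p := by ring
      _ ≤ y * (1 + y) ^ 2 * p := by gcongr
  have hi : Integrable (potentialSeq f M x₀ G₀ u τ (k + 1)) P := by
    refine (hb.add (hint.const_mul (2 * d * y * (1 + y) ^ 2))).mono'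
      (measurable_potential hf.twice (hmeas'.1.mono (ℱ.le _) le_rfl)
        fun i j => (hmeas'.2 i j).mono (ℱ.le _) le_rfl).aestronglyMeasurable
      (Filter.Eventually.of_forall fun ω => ?_)
    have h0 : 0 ≤ potentialSeq f M x₀ G₀ u τ (k + 1) ω :=
      potential_nonneg hf hM (hinv ω (k + 1)).1
    rw [Real.norm_of_nonneg h0]
    exact hstep ω
  refine ⟨hi, ?_⟩
  have hn := two_le_dim_mul_cond hd hf
  have h1 : ∫ ω, potentialSeq f M x₀ G₀ u τ (k + 1) ω ∂P ≤ _ :=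
    integral_mono hi (hb.add (hint.const_mul (2 * d * y * (1 + y) ^ 2))) hstep
  simp only [Pi.add_apply] at h1
  rw [integral_add hb (hint.const_mul _), integral_const_mul] at h1
  have h2 := integral_mono hs (hint.const_mul ((1 + y) ^ 2)) fun ω => by
    have h3 := lam_nonneg f (iterates f M x₀ G₀ (fun i => u i ω) (fun i => τ i ω) k).1
    refine (sigma_corrected_le hf hfM (hinv ω k).1).trans ?_
    refine mul_le_mul_of_nonneg_right ?_ (hp0 ω)
    have := hMl ω
    gcongr
  rw [integral_const_mul] at h2
  have hnn : 0 ≤ 1 - 1 / (d * (L / μ)) := by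
    rw [sub_nonneg, div_le_one (by linarith)]
    linarith
  have h3 := mul_le_mul_of_nonneg_left h2 hnn
  have h4 := mul_le_mul_of_nonneg_right (contraction_factor_le (a := d) hn hy0 (Nat.cast_nonneg d))
    (integral_nonneg (μ := P) hp0)
  linarith

theorem integral_potentialSeq_le [IsProbabilityMeasure P] (hd : 2 ≤ d)
    (hf : StronglyConvexSmooth f μ L) (hfM : StronglySelfConcordant f M) (hη : 1 ≤ η)
    (hG₀_lower : hess f x₀ ≤ G₀) (hG₀_upper : G₀ ≤ η • hess f x₀)
    (hx₀ : M * lam f x₀ ≤ Real.log 2 / (4 * η * (2 * (d : ℝ) + 1)))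
    (hD : IsotropicDirections D) (hchoice : RandomChoices P ℱ D u τ) (k : ℕ) :
    Integrable (potentialSeq f M x₀ G₀ u τ k) P ∧
    ∫ ω, potentialSeq f M x₀ G₀ u τ k ω ∂P ≤ 2 * d * η * (1 - 1 / (d * (L / μ))) ^ k := by
  obtain ⟨hρ0, hρ1⟩ := one_sub_one_div_mem hη
  have hn := two_le_dim_mul_cond hd hf
  have hM := hfM.pos
  have hl0 := lam_nonneg f x₀
  have hsmall := four_mul_le_of_le_log_two_div hd hη hx₀
  have hη0 : 0 < η := by linarith
  have hnn : 0 ≤ 1 - 1 / (d * (L / μ)) := by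
    rw [sub_nonneg, div_le_one (by linarith)]
    linarith
  have hstep := integral_potentialSeq_succ_le hd hf hfM hη hG₀_lower hG₀_upper hx₀ hD hchoice
  have hρη : 2 * η * (1 - (1 - 1 / (2 * η))) = 1 := by
    field_simp
    ring
  have hc0 : 0 ≤ M * lam f x₀ := by positivity
  set c := M * lam f x₀
  set ρ := 1 - 1 / (2 * η)
  have hp0 : 0 ≤ potential f M x₀ G₀ := potential_nonneg hf hM hG₀_lower
  have hp : potential f M x₀ G₀ ≤ d * η := by
    have h1 := sigma_le (hf.posDef x₀) hG₀_upper
    have h2 : 2 * c ≤ 1 := by nlinarith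
    have h3 := mul_le_mul_of_nonneg_left h2 (Nat.cast_nonneg (α := ℝ) d)
    rw [potential]
    linarith
  have main : Integrable (potentialSeq f M x₀ G₀ u τ k) P ∧
      ∫ ω, potentialSeq f M x₀ G₀ u τ k ω ∂P ≤ (1 - 1 / (d * (L / μ))) ^ k *
        Real.exp (4 * η * (2 * d + 1) * c * (1 - ρ ^ k)) * potential f M x₀ G₀ := by
    induction k with
    | zero =>
      refine ⟨integrable_const (potential f M x₀ G₀), le_of_eq ?_⟩
      have : ∫ ω, potentialSeq f M x₀ G₀ u τ 0 ω ∂P = ∫ _ω, potential f M x₀ G₀ ∂P := rfl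
      rw [this]
      simp
    | succ k ih =>
      obtain ⟨h1, h2⟩ := hstep k ih.1
      refine ⟨h1, h2.trans ?_⟩
      refine (mul_le_mul_of_nonneg_left ih.2 (by positivity)).trans_eq ?_
      have e : 4 * η * (2 * d + 1) * c * (1 - ρ ^ (k + 1)) =
          (4 * d + 2) * (ρ ^ k * c) + 4 * η * (2 * d + 1) * c * (1 - ρ ^ k) := by
        rw [pow_succ]
        linear_combination ((4 * d + 2) * ρ ^ k * c) * hρη
      rw [e, Real.exp_add, pow_succ]
      ring
  refine ⟨main.1, main.2.trans ?_⟩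
  -- The accumulated exponent stays below `4η(2d+1)c`, which the assumption on `λ_0` bounds by `ln
  -- 2`.
  have hexp : Real.exp (4 * η * (2 * d + 1) * c * (1 - ρ ^ k)) ≤ 2 := by
    rw [← Real.le_log_iff_exp_le (by norm_num)]
    rw [le_div_iff₀ (by positivity)] at hx₀
    have h1 : 4 * η * (2 * d + 1) * c * (1 - ρ ^ k) ≤ 4 * η * (2 * d + 1) * c :=
      mul_le_of_le_one_right (by positivity) (by linarith [pow_nonneg hρ0 k])
    linarith
  calc (1 - 1 / (d * (L / μ))) ^ k * Real.exp (4 * η * (2 * d + 1) * c * (1 - ρ ^ k))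
        * potential f M x₀ G₀
      ≤ (1 - 1 / (d * (L / μ))) ^ k * 2 * (d * η) := by gcongr
    _ = _ := by ring

/-- Markov's inequality with a union bound, for expectations decaying at a geometric rate. -/
theorem measure_iUnion_le_of_integral_le {X : ℕ → Ω → ℝ} {c q : ℝ} {t : ℕ → ℝ} (hq0 : 0 ≤ q)
    (hq1 : q < 1) (hc : 0 ≤ c) (ht : ∀ k, 0 < t k) (hX : ∀ k ω, 0 ≤ X k ω)
    (hi : ∀ k, Integrable (X k) P) (h : ∀ k, ∫ ω, X k ω ∂P ≤ t k * (c * q ^ k)) :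
    P (⋃ k, {ω | t k ≤ X k ω}) ≤ ENNReal.ofReal (c / (1 - q)) := by
  have hk : ∀ k, P {ω | t k ≤ X k ω} ≤ ENNReal.ofReal (c * q ^ k) := fun k => by
    have h1 := (mul_meas_ge_le_integral_of_nonneg (Filter.Eventually.of_forall (hX k)) (hi k)
      (t k)).trans (h k)
    have h2 := le_of_mul_le_mul_left h1 (ht k)
    have hfin : P {ω | t k ≤ X k ω} ≠ ⊤ := ((hi k).measure_ge_lt_top (ht k)).ne
    rw [← ENNReal.ofReal_toReal hfin]
    exact ENNReal.ofReal_le_ofReal h2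
  refine (measure_iUnion_le _).trans ((ENNReal.tsum_le_tsum hk).trans_eq ?_)
  rw [← ENNReal.ofReal_tsum_of_nonneg (fun k => by positivity)
    ((summable_geometric_of_lt_one hq0 hq1).mul_left c), tsum_mul_left,
    tsum_geometric_of_lt_one hq0 hq1, div_eq_mul_inv]

/-- Splits the rate in expectation into the slightly slower rate of the theorem and a surplus that
makes the union bound converge. -/
theorem one_sub_one_div_eq {n : ℝ} (hn : 0 < n) :
    1 - 1 / n = (1 - 1 / (n + 1)) * (1 - 1 / n ^ 2) := by
  field_simp
  ring

/-- The divisions are exact: `k(k-1)/2` is the sum of `0, …, k-1`. -/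
theorem succ_mul_div_two (k : ℕ) : (k + 1) * (k + 1 - 1) / 2 = k * (k - 1) / 2 + k := by
  rw [← Finset.sum_range_id_mul_two, ← Finset.sum_range_id_mul_two,
    Nat.mul_div_cancel _ two_pos, Nat.mul_div_cancel _ two_pos, Finset.sum_range_succ]

end Random

end RandomBroyden

/-! ### The high-probability bounds -/

theorem mainTheorem6 {d : ℕ} (hd : 2 ≤ d)
    (f : RandomBroyden.Vec d → ℝ) (μ L M : ℝ)
    (hf : RandomBroyden.StronglyConvexSmooth f μ L)
    (hfM : RandomBroyden.StronglySelfConcordant f M)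
    (x₀ : RandomBroyden.Vec d) (G₀ : RandomBroyden.Mat d) (η : ℝ) (hη : 1 ≤ η)
    (hG₀_lower : RandomBroyden.hess f x₀ ≤ G₀)
    (hG₀_upper : G₀ ≤ η • RandomBroyden.hess f x₀)
    (hx₀ : M * RandomBroyden.lam f x₀ ≤ Real.log 2 / (4 * η * (2 * (d : ℝ) + 1)))
    (D : Measure (RandomBroyden.Vec d)) [IsProbabilityMeasure D]
    (hD : RandomBroyden.IsotropicDirections D)
    {Ω : Type*} [m : MeasurableSpace Ω] (P : Measure Ω) [IsProbabilityMeasure P]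
    (ℱ : Filtration ℕ m) (u : ℕ → Ω → RandomBroyden.Vec d) (τ : ℕ → Ω → ℝ)
    (hchoice : RandomBroyden.RandomChoices P ℱ D u τ)
    (δ : ℝ) (hδ₀ : 0 < δ) (hδ₁ : δ < 1) :
    ENNReal.ofReal (1 - δ) ≤ P {ω | ∀ k : ℕ,
      RandomBroyden.sigmaSeq f M x₀ G₀ (fun i => u i ω) (fun i => τ i ω) k
          ≤ 4 * (d : ℝ) ^ 3 * (L / μ) ^ 2 * η / δ * (1 - 1 / ((d : ℝ) * (L / μ) + 1)) ^ k ∧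
      RandomBroyden.lamSeq f M x₀ G₀ (fun i => u i ω) (fun i => τ i ω) k
          ≤ (4 * (d : ℝ) ^ 3 * (L / μ) ^ 2 * η / δ) ^ k
              * (1 - 1 / ((d : ℝ) * (L / μ) + 1)) ^ (k * (k - 1) / 2)
              * RandomBroyden.lam f x₀} := by
  open RandomBroyden in
  have hn := two_le_dim_mul_cond hd hf
  have hM := hfM.pos
  have hL := hf.pos_L
  have hμ := hf.pos_mu
  have hd0 : (0 : ℝ) < d := by exact_mod_cast (by omega : 0 < d)
  obtain ⟨hρ0, hρ1⟩ := one_sub_one_div_mem hη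
  have hinv := fun ω => iterates_invariants hd hf hfM hη hG₀_lower hG₀_upper hx₀
    (u := fun i => u i ω) (τ := fun i => τ i ω) (fun i => hchoice.tau_mem i ω)
  have hE := integral_potentialSeq_le hd hf hfM hη hG₀_lower hG₀_upper hx₀ hD hchoice
  set n := (d : ℝ) * (L / μ) with hndef
  set C := 4 * (d : ℝ) ^ 3 * (L / μ) ^ 2 * η / δ with hCdef
  set q := 1 - 1 / (n + 1) with hqdef
  have hC : C = 4 * d * η * n ^ 2 / δ := by
    rw [hCdef, hndef]
    ring
  have hC0 : 0 < C := by positivity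
  have hq0 : 0 < q := by
    rw [hqdef, sub_pos, div_lt_one (by linarith)]
    linarith
  have hp0 : ∀ k ω, 0 ≤ potentialSeq f M x₀ G₀ u τ k ω := fun k ω =>
    potential_nonneg hf hM (hinv ω k).1
  have hn2 : 1 / n ^ 2 < 1 := by
    rw [div_lt_one (by positivity)]
    nlinarith
  have hn2' : 0 < 1 / n ^ 2 := by positivity
  -- Twice the potential is controlled because `λ_{k+1} ≤ 2 p_k λ_k`. As `C = 4dηn²/δ`, the `k`-th
  -- failure has probability at most `(δ/n²)(1 - 1/n²)^k`, and these sum to `δ`.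
  have hbad := measure_iUnion_le_of_integral_le (P := P)
    (X := fun k ω => 2 * potentialSeq f M x₀ G₀ u τ k ω) (c := δ / n ^ 2) (q := 1 - 1 / n ^ 2)
    (t := fun k => C * q ^ k) (by linarith) (by linarith) (by positivity)
    (fun k => by positivity) (fun k ω => mul_nonneg zero_le_two (hp0 k ω))
    (fun k => (hE k).1.const_mul 2) (fun k => by
      rw [integral_const_mul]
      refine (mul_le_mul_of_nonneg_left (hE k).2 zero_le_two).trans_eq ?_
      rw [one_sub_one_div_eq (by linarith : 0 < n), ← hqdef, mul_pow, hC]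
      generalize 1 - 1 / n ^ 2 = z
      field_simp
      ring)
  have hδeq : δ / n ^ 2 / (1 - (1 - 1 / n ^ 2)) = δ := by
    field_simp
    ring
  rw [hδeq] at hbad
  set bad := ⋃ k, {ω | C * q ^ k ≤ 2 * potentialSeq f M x₀ G₀ u τ k ω} with hbaddef
  have hsub : badᶜ ⊆ {ω | ∀ k : ℕ,
      sigmaSeq f M x₀ G₀ (fun i => u i ω) (fun i => τ i ω) k ≤ C * q ^ k ∧
      lamSeq f M x₀ G₀ (fun i => u i ω) (fun i => τ i ω) k
          ≤ C ^ k * q ^ (k * (k - 1) / 2) * lam f x₀} := by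
    intro ω hω
    have hgood : ∀ k, 2 * potentialSeq f M x₀ G₀ u τ k ω ≤ C * q ^ k := fun k => by
      by_contra! h
      exact hω (Set.mem_iUnion.2 ⟨k, h.le⟩)
    intro k
    constructor
    · have h1 : sigmaSeq f M x₀ G₀ (fun i => u i ω) (fun i => τ i ω) k
          ≤ potentialSeq f M x₀ G₀ u τ k ω := sigma_le_potential hM
      linarith [hgood k, hp0 k ω]
    · induction k with
      | zero => simp [lamSeq, iterates]
      | succ k ih =>
        have h1 := lam_newtonStep_le_potential (by omega) hf hfM (hinv ω k).1
        have h2 := lam_nonneg f (iterates f M x₀ G₀ (fun i => u i ω) (fun i => τ i ω) k).1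
        have h3 : 1 + M / 2 * lam f (iterates f M x₀ G₀ (fun i => u i ω) (fun i => τ i ω) k).1
            ≤ 2 := by
          have h4 := mul_le_mul_of_nonneg_left ((hinv ω k).2.2.trans
            (mul_le_of_le_one_left (lam_nonneg f x₀) (pow_le_one₀ hρ0 hρ1))) hM.le
          have h5 := four_mul_le_of_le_log_two_div hd hη hx₀
          nlinarith [mul_nonneg hM.le (lam_nonneg f x₀)]
        have h6 := mul_le_mul_of_nonneg_right h3 (hp0 k ω)
        have h7 := mul_le_mul (h6.trans (hgood k)) ih h2 (by positivity)
        refine (h1.trans h7).trans_eq ?_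
        rw [succ_mul_div_two, pow_add, pow_succ]
        ring
  refine le_trans ?_ (measure_mono hsub)
  -- Subadditivity suffices, so the measurability of the events is not needed.
  have h1 : (1 : ENNReal) ≤ P bad + P badᶜ := by
    rw [← measure_univ (μ := P), ← Set.union_compl_self bad]
    exact measure_union_le _ _
  rw [ENNReal.ofReal_sub 1 hδ₀.le, ENNReal.ofReal_one, tsub_le_iff_left]
  exact h1.trans (add_le_add_left hbad _)
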